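/- Let $K$ be a field of characteristic $0$, let $V_3$ be the $4$-dimensional $SL_2$-module of binary cubic forms over $K$, and let $\mathcal I = K[V_3\oplus V_3]^{SL_2}$ be the algebra of polynomial $SL_2$-invariant functions on $V_3\oplus V_3$, graded by the degree of polynomials. Then $\mathcal I$ has a finite minimal (that is, irredundant) system of homogeneous generators. Let $f_1,\dots,f_m$ be any such system, let $R = K[x_1,\dots,x_m]$ be graded by $\deg x_i = \deg f_i$, and regard $\mathcal I$ as a graded $R$-module through $\varphi : R\to\mathcal I$, $x_i\mapsto f_i$. Then: 1. $\mathcal I$ is a complete intersection with two relations, of degrees $8$ and $12$: the map $\varphi$ is surjective, and $\ker\varphi = (r_1,r_2)$ for a regular sequence $r_1,r_2$ of homogeneous elements of $R$ of degrees $8$ and $12$. 2. The minimal graded free resolution of $\mathcal I$ over $R$ has the form $$0\longrightarrow R(-20)\longrightarrow R(-8)\oplus R(-12)\longrightarrow R\longrightarrow \mathcal I\longrightarrow 0,$$ that is, there is such an exact sequence of $R$-linear maps of degree $0$ in which all entries of the matrices of the maps between free modules lie in $(x_1,\dots,x_m)$. 3. The homological (projective) dimension of the $R$-module $\mathcal I$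 is $2$. -/

import Mathlib

open scoped MatrixGroups

namespace BinaryInvariants

noncomputable section

open MvPolynomial

/-! ### Binary forms and the action of `SL₂` -/

/-- The binary form `∑ i, a i * x ^ (d - i) * y ^ i` of degree `d` with coefficient vector `a`;
`x = X 0`, `y = X 1`. The `(d + 1)`-dimensional space `V_d` of binary forms of degree `d` is
`Fin (d + 1) → K` through this parametrization. -/
def binaryForm {K : Type*} [Field K] {d : ℕ} (a : Fin (d + 1) → K) : MvPolynomial (Fin 2) K :=
  ∑ i : Fin (d + 1), C (a i) * X 0 ^ (d - (i : ℕ)) * X 1 ^ (i : ℕ)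

/-- The action of `g ∈ SL₂(K)` on polynomials in `x, y`, viewed as functions on `K²`:
`(g • F)(v) = F (g⁻¹ v)`. -/
def linSubst {K : Type*} [Field K] (g : SL(2, K)) :
    MvPolynomial (Fin 2) K →ₐ[K] MvPolynomial (Fin 2) K :=
  aeval fun i : Fin 2 => ∑ j : Fin 2, C ((g⁻¹ : SL(2, K)) i j) * X j

/-- The action of `SL₂(K)` on `V_d` in coefficients: the `i`-th coefficient of `act g a` is the
coefficient of `x ^ (d - i) * y ^ i` in `g • binaryForm a`. -/
def act {K : Type*} [Field K] {d : ℕ} (g : SL(2, K)) (a : Fin (d + 1) → K) : Fin (d + 1) → K :=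
  fun i => coeff (Finsupp.single 0 (d - (i : ℕ)) + Finsupp.single 1 (i : ℕ))
    (linSubst g (binaryForm a))

theorem binaryForm_isHomogeneous {K : Type*} [Field K] {d : ℕ} (a : Fin (d + 1) → K) :
    (binaryForm a).IsHomogeneous d := by
  refine IsHomogeneous.sum _ _ _ fun i _ => ?_
  have h := ((isHomogeneous_C (Fin 2) (a i)).mul
    ((isHomogeneous_X K (0 : Fin 2)).pow (d - (i : ℕ)))).mul
    ((isHomogeneous_X K (1 : Fin 2)).pow (i : ℕ))
  have e : 0 + 1 * (d - (i : ℕ)) + 1 * (i : ℕ) = d := by omega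
  rwa [e] at h

theorem eq_binaryForm_of_isHomogeneous {K : Type*} [Field K] {d : ℕ}
    {F : MvPolynomial (Fin 2) K} (hF : F.IsHomogeneous d) :
    F = binaryForm fun i : Fin (d + 1) =>
      coeff (Finsupp.single 0 (d - (i : ℕ)) + Finsupp.single 1 (i : ℕ)) F := by
  classical
  have key : ∀ (c : K) (p q : ℕ), C c * X 0 ^ p * X 1 ^ q
      = monomial (Finsupp.single (0 : Fin 2) p + Finsupp.single 1 q) c := by
    intro c p q
    rw [X_pow_eq_monomial, X_pow_eq_monomial, C_mul_monomial, monomial_mul]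
    simp
  ext m
  unfold binaryForm
  simp only [key, coeff_sum, coeff_monomial]
  by_cases hm : m 0 + m 1 = d
  · have hm1 : m 1 < d + 1 := by omega
    have hmeq : Finsupp.single (0 : Fin 2) (d - m 1) + Finsupp.single 1 (m 1) = m := by
      ext i
      fin_cases i <;> simp
      omega
    rw [Finset.sum_eq_single (⟨m 1, hm1⟩ : Fin (d + 1))]
    · simp only [hmeq, if_true]
    · intro b _ hb
      rw [if_neg]
      intro h
      apply hb
      ext
      have := DFunLike.congr_fun h 1
      simpa using this
    · simp
  · have h0 : coeff m F = 0 := by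
      by_contra h
      apply hm
      have := hF h
      simpa [Finsupp.weight_apply, Finsupp.sum_fintype, Fin.sum_univ_two] using this
    rw [h0, Finset.sum_eq_zero]
    intro i _
    rw [if_neg]
    intro h
    apply hm
    have e0 := DFunLike.congr_fun h 0
    have e1 := DFunLike.congr_fun h 1
    simp at e0 e1
    omega

/-- The coefficient action is the action on forms. -/
theorem binaryForm_act {K : Type*} [Field K] {d : ℕ} (g : SL(2, K)) (a : Fin (d + 1) → K) :
    binaryForm (act g a) = linSubst g (binaryForm a) := by
  symm
  apply eq_binaryForm_of_isHomogeneous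
  have h := (binaryForm_isHomogeneous a).aeval
    (fun i : Fin 2 => ∑ j : Fin 2, (C ((g⁻¹ : SL(2, K)) i j) * X j : MvPolynomial (Fin 2) K))
    (n := 1) (fun i => IsHomogeneous.sum _ _ _ fun j _ => by
      simpa using (isHomogeneous_C (Fin 2) ((g⁻¹ : SL(2, K)) i j)).mul (isHomogeneous_X K j))
  rw [one_mul] at h
  exact h

/-! ### The algebra of invariants -/

/-- The algebra `K[V_d ⊕ ⋯ ⊕ V_d]^{SL₂}` (`n` summands) of polynomial invariants of `n` binary
forms of degree `d`. A polynomial function on `V_d ⊕ ⋯ ⊕ V_d` is a polynomial in the variables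
`X (j, i)`, where `X (j, i)` is the `i`-th coefficient of the `j`-th form. -/
def invariants (K : Type*) [Field K] (n d : ℕ) :
    Subalgebra K (MvPolynomial (Fin n × Fin (d + 1)) K) where
  carrier := {P | ∀ (g : SL(2, K)) (a : Fin n → Fin (d + 1) → K),
    eval (fun s => act g (a s.1) s.2) P = eval (fun s => a s.1 s.2) P}
  mul_mem' hP hQ g a := by simp only [map_mul, hP g a, hQ g a]
  add_mem' hP hQ g a := by simp only [map_add, hP g a, hQ g a]
  algebraMap_mem' r g a := by simp [algebraMap_eq]

/-- The invariants that are homogeneous of degree `e`. -/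
def invariantsOfDegree (K : Type*) [Field K] (n d : ℕ) (e : ℕ) :
    Submodule K (invariants K n d) :=
  (homogeneousSubmodule (Fin n × Fin (d + 1)) K e).comap (invariants K n d).val.toLinearMap

/-- `f 0, …, f (m - 1)` is a minimal system of homogeneous generators of the `K`-algebra `A`,
graded by `𝒜`, and `f i` is homogeneous of degree `w i`. -/
structure IsMinimalGenerators {K A : Type*} [Field K] [CommRing A] [Algebra K A]
    (𝒜 : ℕ → Submodule K A) {m : ℕ} (f : Fin m → A) (w : Fin m → ℕ) : Prop where
  homogeneous : ∀ i, f i ∈ 𝒜 (w i)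
  generates : Algebra.adjoin K (Set.range f) = ⊤
  irredundant : ∀ i, f i ∉ Algebra.adjoin K (f '' {j | j ≠ i})

/-! ### Graded free resolutions -/

/-- For `R = K[x_1, …, x_m]` with `deg x_i = w i` and `c = [c_1, …, c_r]`, the elements of degree
`e` of the graded free `R`-module `R(-c_1) ⊕ ⋯ ⊕ R(-c_r)`, where `R(-c)_e = R_{e - c}`: every
monomial `μ` of the `s`-th entry satisfies `deg μ + c_s = e`. -/
def twistedDegree {K : Type*} [Field K] {m : ℕ} (w : Fin m → ℕ) (c : List ℕ) (e : ℕ) :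
    Submodule K (Fin c.length → MvPolynomial (Fin m) K) where
  carrier := {v | ∀ s μ, coeff μ (v s) ≠ 0 → Finsupp.weight w μ + c.get s = e}
  add_mem' {u v} hu hv s μ h := by
    by_cases h' : coeff μ (u s) = 0
    · refine hv s μ fun h'' => h ?_
      simp [h', h'']
    · exact hu s μ h'
  zero_mem' s μ h := absurd (by simp) h
  smul_mem' r v hv s μ h := hv s μ fun h' => h (by simp [h'])

/-- Let `R = K[x_1, …, x_m]` with `deg x_i = w i`, and let `A` be a `K`-algebra graded by `𝒜`,
regarded as an `R`-module through `φ : R → A`. For a list `c = [c₀, …, c_l]` of lists of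
natural numbers put `F_i = ⨁ j ∈ c_i, R(-j)` for `i ≤ l` and `F_i = 0` for `i > l`. The predicate
says that `A` has a minimal graded free resolution
`0 ⟶ F_l ⟶ ⋯ ⟶ F_1 ⟶ F_0 ⟶ A ⟶ 0`: an exact sequence of `R`-linear maps of degree zero
such that the entries of the matrices of all `F_{i+1} ⟶ F_i` have zero constant term. -/
def HasMinimalFreeResolution {K A : Type*} [Field K] [CommRing A] [Algebra K A]
    (𝒜 : ℕ → Submodule K A) {m : ℕ} (w : Fin m → ℕ) (φ : MvPolynomial (Fin m) K →ₐ[K] A)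
    (c : List (List ℕ)) : Prop :=
  ∃ (ε : (Fin (c.getD 0 []).length → MvPolynomial (Fin m) K)
        →ₛₗ[(φ : MvPolynomial (Fin m) K →+* A)] A)
    (δ : ∀ i : ℕ, (Fin (c.getD (i + 1) []).length → MvPolynomial (Fin m) K)
        →ₗ[MvPolynomial (Fin m) K] (Fin (c.getD i []).length → MvPolynomial (Fin m) K)),
    Function.Surjective ε ∧
    Function.Exact (δ 0) ε ∧
    (∀ i, Function.Exact (δ (i + 1)) (δ i)) ∧
    (∀ e, ∀ v ∈ twistedDegree w (c.getD 0 []) e, ε v ∈ 𝒜 e) ∧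
    (∀ i e, ∀ v ∈ twistedDegree w (c.getD (i + 1) []) e,
      δ i v ∈ twistedDegree w (c.getD i []) e) ∧
    (∀ i v s, constantCoeff (δ i v s) = 0)

/-- The homological (projective) dimension of `A` as an `R`-module through `φ : R → A`. -/
def homologicalDimension {R A : Type*} [CommRing R] [CommRing A] (φ : R →+* A) : WithBot ℕ∞ :=
  CategoryTheory.projectiveDimension
    (@ModuleCat.of R _ A _ (Module.compHom A φ))

end

end BinaryInvariants

/-!
The seven basic invariants are the polarizations of the discriminant, the invariant alternating
pairing of cubic forms, and the area spanned by two linear covariants. They satisfy two relations,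
and the main point is that they generate all invariants and have no further relations.

For the relations, consider a polynomial `p` vanishing on the basic invariants. Restricted to the
pairs whose first form is `x ^ 2 * y`, the discriminant `X 0` vanishes, and there `p` is seen to be
a combination of the two known relations; the graded Nakayama lemma lifts this from modulo `X 0`.

For generation, a linear covariant of the pair and its image under the Hessian of the first form
are a frame of the plane outside the zero locus of their area `D`. In that frame the coefficients
of both forms are basic invariants divided by powers of `D`, so `D ^ N * P` is a polynomial in the
basic invariants for every invariant `P`. Exchanging the two forms gives a second denominator `D'`.
The two relations followed by `D`, `D'` form a regular sequence, since after adjoining some of the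
variables they degenerate to squares of variables; hence both denominators cancel.

The resolution is then the Koszul complex of the two relations. Two minimal systems of generators
differ by a graded isomorphism of polynomial rings, which carries everything to an arbitrary one.
-/

namespace BinaryInvariants

open MvPolynomial RingTheory.Sequence

/-! ### Graded Nakayama and regular sequences -/

section Graded

variable {A σ : Type*} [CommRing A] [SetLike σ A] [AddSubmonoidClass σ A] (𝒜 : ℕ → σ)
  [GradedRing 𝒜] {N J : Ideal A} {a : A} {k : ℕ}

open DirectSum Pointwise

theorem graded_nakayama (hJ : J.IsHomogeneous 𝒜) (hk : 0 < k)
    (ha : a ∈ 𝒜 k) (h : N ≤ J ⊔ Ideal.span {a} * N) : N ≤ J := by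
  suffices key : ∀ d, ∀ x ∈ N, (decompose 𝒜 x d : A) ∈ J from
    fun x hx => hJ.mem_iff.2 fun d => key d x hx
  intro d
  induction d using Nat.strong_induction_on with
  | _ d ih =>
    intro x hx
    obtain ⟨y, hy, z, hz, rfl⟩ := Submodule.mem_sup.1 (h hx)
    obtain ⟨z, hzN, rfl⟩ := Ideal.mem_span_singleton_mul.1 hz
    rw [decompose_add, DirectSum.add_apply, AddMemClass.coe_add]
    refine J.add_mem (hJ d hy) ?_
    by_cases hkd : k ≤ d
    · rw [coe_decompose_mul_of_left_mem_of_le 𝒜 ha hkd]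
      exact J.mul_mem_left a (ih (d - k) (by omega) z hzN)
    · rw [coe_decompose_mul_of_left_mem_of_not_le 𝒜 ha hkd]
      exact J.zero_mem

theorem eq_of_le_sup_span_singleton (hJ : J.IsHomogeneous 𝒜)
    (hk : 0 < k) (ha : a ∈ 𝒜 k) (hreg : IsSMulRegular (A ⧸ N) a) (hJN : J ≤ N)
    (h : N ≤ J ⊔ Ideal.span {a}) : N = J := by
  refine le_antisymm (graded_nakayama 𝒜 hJ hk ha fun x hx => ?_) hJN
  obtain ⟨y, hy, z, hz, rfl⟩ := Submodule.mem_sup.1 (h hx)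
  obtain ⟨z, rfl⟩ := Ideal.mem_span_singleton.1 hz
  have hzN : z ∈ N := (isSMulRegular_quotient_iff_mem_of_smul_mem N a).1 hreg z
    ((N.add_mem_iff_right (hJN hy)).1 hx)
  exact Submodule.add_mem_sup hy (Ideal.mul_mem_mul (Ideal.mem_span_singleton_self a) hzN)

theorem torsionBy_eq_bot_of_eq_smul {b : A} (hJ : J.IsHomogeneous 𝒜) (hk : 0 < k)
    (ha : a ∈ 𝒜 k)
    (h : Submodule.torsionBy A (A ⧸ J) b = a • Submodule.torsionBy A (A ⧸ J) b) :
    Submodule.torsionBy A (A ⧸ J) b = ⊥ := by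
  have hmk : ∀ x, Ideal.Quotient.mk J x ∈ Submodule.torsionBy A (A ⧸ J) b ↔ b * x ∈ J :=
    fun x => by rw [Submodule.mem_torsionBy_iff, ← Ideal.Quotient.eq_zero_iff_mem]; rfl
  have hN : Submodule.comap (LinearMap.mulLeft A b) J ≤ J := by
    refine graded_nakayama 𝒜 hJ hk ha fun x hx => ?_
    have hx' := (hmk x).2 hx
    rw [h] at hx'
    obtain ⟨z, hz, hzx⟩ := (Submodule.mem_smul_pointwise_iff_exists _ _ _).1 hx'
    obtain ⟨z, rfl⟩ := Ideal.Quotient.mk_surjective z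
    have hxz : x - a * z ∈ J := Ideal.Quotient.eq.1 hzx.symm
    rw [← sub_add_cancel x (a * z)]
    exact Submodule.add_mem_sup hxz
      (Ideal.mul_mem_mul (Ideal.mem_span_singleton_self a) ((hmk z).1 hz))
  refine (Submodule.eq_bot_iff _).2 fun x hx => ?_
  obtain ⟨x, rfl⟩ := Ideal.Quotient.mk_surjective x
  exact Ideal.Quotient.eq_zero_iff_mem.2 (hN ((hmk x).1 hx))

theorem isWeaklyRegular_of_perm {rs rs' : List A} (h : IsWeaklyRegular A rs)
    (hperm : rs.Perm rs') (hpos : ∀ r ∈ rs, ∃ k, 0 < k ∧ r ∈ 𝒜 k) : IsWeaklyRegular A rs' := by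
  refine h.prototype_perm hperm fun a b l hl => ?_
  have hmem : ∀ r ∈ a :: b :: l, ∃ k, 0 < k ∧ r ∈ 𝒜 k := fun r hr => hpos r (hl.subset hr)
  obtain ⟨k, hk, ha⟩ := hmem a (by simp)
  have hJ : (Ideal.ofList l).IsHomogeneous 𝒜 := Ideal.homogeneous_span 𝒜 _ fun r hr => by
    obtain ⟨k, -, h⟩ := hmem r (List.mem_cons_of_mem _ (List.mem_cons_of_mem _ hr))
    exact ⟨k, h⟩
  rw [smul_eq_mul, Ideal.mul_top]
  exact torsionBy_eq_bot_of_eq_smul 𝒜 hJ hk ha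

end Graded

section RegularSequence

variable {A : Type*} [CommRing A] {rs : List A} {a b : A}

theorem isWeaklyRegular_concat_iff :
    IsWeaklyRegular A (rs ++ [a]) ↔
      IsWeaklyRegular A rs ∧ IsSMulRegular (A ⧸ Ideal.ofList rs) a := by
  rw [isWeaklyRegular_append_iff, isWeaklyRegular_singleton_iff, smul_eq_mul, Ideal.mul_top]

theorem isWeaklyRegular_concat_pow (h : IsWeaklyRegular A (rs ++ [a])) (n : ℕ) :
    IsWeaklyRegular A (rs ++ [a ^ n]) := by
  rw [isWeaklyRegular_concat_iff] at h ⊢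
  exact ⟨h.1, h.2.pow n⟩

theorem isSMulRegular_quotient_congr {J : Ideal A} {u : A} (hu : IsUnit u) (h : b - u * a ∈ J)
    (ha : IsSMulRegular (A ⧸ J) a) : IsSMulRegular (A ⧸ J) b := by
  rw [isSMulRegular_quotient_iff_mem_of_smul_mem] at ha ⊢
  intro x hx
  have hax : u * (a * x) ∈ J := by
    have := J.sub_mem hx (J.mul_mem_right x h)
    convert this using 1
    simp only [smul_eq_mul]
    ring
  exact ha x ((Ideal.unit_mul_mem_iff_mem J hu).1 hax)

theorem sup_span_singleton_congr {J : Ideal A} {u : A} (hu : IsUnit u) (h : b - u * a ∈ J) :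
    J ⊔ Ideal.span {b} = J ⊔ Ideal.span {a} := by
  have hspan : ∀ c d : A, c - d ∈ J → J ⊔ Ideal.span {c} ≤ J ⊔ Ideal.span {d} := by
    intro c d hcd
    refine sup_le le_sup_left ((Ideal.span_singleton_le_iff_mem _).2 ?_)
    rw [← sub_add_cancel c d]
    exact Submodule.add_mem_sup hcd (Ideal.mem_span_singleton_self d)
  rw [← Ideal.span_singleton_mul_left_unit hu a]
  exact le_antisymm (hspan _ _ h) (hspan _ _ (by rwa [← neg_sub, neg_mem_iff]))

theorem isWeaklyRegular_congr {u : A} (hu : IsUnit u) (h : b - u * a ∈ Ideal.ofList rs)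
    {rs' : List A} (ha : IsWeaklyRegular A (rs ++ a :: rs')) :
    IsWeaklyRegular A (rs ++ b :: rs') := by
  induction rs' using List.reverseRecOn with
  | nil =>
    rw [isWeaklyRegular_concat_iff] at ha ⊢
    exact ⟨ha.1, isSMulRegular_quotient_congr hu h ha.2⟩
  | append_singleton l c ih =>
    rw [← List.cons_append, ← List.append_assoc, isWeaklyRegular_concat_iff] at ha ⊢
    have hideal : Ideal.ofList (rs ++ b :: l) = Ideal.ofList (rs ++ a :: l) := by
      simp only [Ideal.ofList_append, Ideal.ofList_cons, ← sup_assoc,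
        sup_span_singleton_congr hu h]
    exact ⟨ih ha.1, hideal ▸ ha.2⟩

end RegularSequence

section Monomials

variable {σ R : Type*} [CommRing R]

theorem mem_ofList_X_pow_iff (e : σ → ℕ) (l : List σ) {p : MvPolynomial σ R} :
    p ∈ Ideal.ofList (l.map fun i => (X i : MvPolynomial σ R) ^ e i) ↔
      ∀ μ ∈ p.support, ∃ i ∈ l, e i ≤ μ i := by
  have himage : {r | r ∈ l.map fun i => (X i : MvPolynomial σ R) ^ e i} =
      (fun μ => monomial μ (1 : R)) '' ((fun i => Finsupp.single i (e i)) '' {i | i ∈ l}) := by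
    ext r
    simp [X_pow_eq_monomial]
  rw [Ideal.ofList, himage, mem_ideal_span_monomial_image]
  simp [Finsupp.single_le_iff]

theorem isWeaklyRegular_X_pow (e : σ → ℕ) {l : List σ} (hl : l.Nodup) :
    IsWeaklyRegular (MvPolynomial σ R) (l.map fun i => (X i : MvPolynomial σ R) ^ e i) := by
  classical
  induction l using List.reverseRecOn with
  | nil => exact .nil _ _
  | append_singleton l i ih =>
    obtain ⟨hnodup, -, hi⟩ := List.nodup_append'.1 hl
    rw [List.map_append, List.map_singleton, isWeaklyRegular_concat_iff,
      isSMulRegular_quotient_iff_mem_of_smul_mem]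
    refine ⟨ih hnodup, fun p hp => ?_⟩
    rw [mem_ofList_X_pow_iff] at hp ⊢
    intro μ hμ
    obtain ⟨j, hj, hle⟩ := hp (Finsupp.single i (e i) + μ) (by
      rw [mem_support_iff] at hμ ⊢
      rwa [smul_eq_mul, X_pow_eq_monomial, coeff_monomial_mul, one_mul])
    have hij : i ≠ j := by
      rintro rfl
      exact hi hj (by simp)
    exact ⟨j, hj, by simpa [Finsupp.single_apply, hij] using hle⟩

end Monomials

/-! ### The Koszul resolution -/

section Koszul

universe u

variable {R : Type u} [CommRing R] {r₁ r₂ : R}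

theorem isWeaklyRegular_pair_iff :
    IsWeaklyRegular R [r₁, r₂] ↔
      IsSMulRegular R r₁ ∧ IsSMulRegular (R ⧸ Ideal.span {r₁}) r₂ := by
  rw [← List.singleton_append, isWeaklyRegular_concat_iff, isWeaklyRegular_singleton_iff,
    Ideal.ofList_singleton]

theorem exists_of_mul_add_mul_eq_zero (h : IsWeaklyRegular R [r₁, r₂]) {x y : R}
    (hxy : r₁ * x + r₂ * y = 0) : ∃ z, x = -r₂ * z ∧ y = r₁ * z := by
  obtain ⟨h₁, h₂⟩ := isWeaklyRegular_pair_iff.1 h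
  have hy : r₂ * y ∈ Ideal.span {r₁} :=
    Ideal.mem_span_singleton.2 ⟨-x, by linear_combination hxy⟩
  obtain ⟨z, rfl⟩ := Ideal.mem_span_singleton.1
    ((isSMulRegular_quotient_iff_mem_of_smul_mem _ _).1 h₂ y hy)
  exact ⟨z, h₁ (by simp only [smul_eq_mul]; linear_combination hxy), rfl⟩

/-- The surjection `R² → (r₁, r₂)`, `(x, y) ↦ x r₁ + y r₂`, the last map of the Koszul complex of
`r₁, r₂`. -/
def spanPairMap (r₁ r₂ : R) : R × R →ₗ[R] Ideal.span {r₁, r₂} :=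
  (LinearMap.toSpanSingleton R _ ⟨r₁, Ideal.subset_span (by simp)⟩).coprod
    (LinearMap.toSpanSingleton R _ ⟨r₂, Ideal.subset_span (by simp)⟩)

theorem coe_spanPairMap (v : R × R) : (spanPairMap r₁ r₂ v : R) = v.1 * r₁ + v.2 * r₂ := rfl

theorem spanPairMap_surjective : Function.Surjective (spanPairMap r₁ r₂) := by
  rintro ⟨x, hx⟩
  obtain ⟨a, b, hab⟩ := Ideal.mem_span_pair.1 hx
  exact ⟨(a, b), Subtype.ext hab⟩

theorem ker_spanPairMap (h : IsWeaklyRegular R [r₁, r₂]) :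
    LinearMap.ker (spanPairMap r₁ r₂) =
      LinearMap.range (LinearMap.toSpanSingleton R (R × R) (-r₂, r₁)) := by
  ext ⟨x, y⟩
  rw [LinearMap.mem_ker, LinearMap.mem_range, ← Submodule.coe_eq_zero, coe_spanPairMap]
  constructor
  · intro hv
    obtain ⟨z, rfl, rfl⟩ := exists_of_mul_add_mul_eq_zero h (x := x) (y := y)
      (by linear_combination hv)
    exact ⟨z, by simp [mul_comm]⟩
  · rintro ⟨z, hz⟩
    obtain ⟨rfl, rfl⟩ := Prod.ext_iff.1 hz
    simp
    ring

theorem projective_ker_spanPairMap (h : IsWeaklyRegular R [r₁, r₂]) :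
    Module.Projective R (LinearMap.ker (spanPairMap r₁ r₂)) := by
  rw [ker_spanPairMap h]
  refine Module.Projective.of_equiv (LinearEquiv.ofInjective
    (LinearMap.toSpanSingleton R (R × R) (-r₂, r₁)) fun x y hxy => ?_)
  refine (isWeaklyRegular_pair_iff.1 h).1 ?_
  simpa [mul_comm] using congrArg Prod.snd hxy

theorem not_projective_span_pair (h : IsRegular R [r₁, r₂]) :
    ¬ Module.Projective R (Ideal.span {r₁, r₂}) := by
  intro hproj
  obtain ⟨s, hs⟩ := Module.projective_lifting_property (spanPairMap r₁ r₂) LinearMap.id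
    spanPairMap_surjective
  let e₁ : Ideal.span {r₁, r₂} := ⟨r₁, Ideal.subset_span (by simp)⟩
  let e₂ : Ideal.span {r₁, r₂} := ⟨r₂, Ideal.subset_span (by simp)⟩
  have hsyz : r₂ • s e₁ = r₁ • s e₂ := by
    rw [← map_smul, ← map_smul]
    exact congrArg s (Subtype.ext (mul_comm r₂ r₁))
  obtain ⟨hfst, hsnd⟩ := Prod.ext_iff.1 hsyz
  have hdvd : ∀ x y : R, r₂ * x = r₁ * y → ∃ z, x = r₁ * z := fun x y hxy => by
    obtain ⟨z, -, hz⟩ := exists_of_mul_add_mul_eq_zero h.toIsWeaklyRegular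
      (x := -y) (y := x) (by linear_combination hxy)
    exact ⟨z, hz⟩
  obtain ⟨α, hα⟩ := hdvd _ _ hfst
  obtain ⟨β, hβ⟩ := hdvd _ _ hsnd
  have hsec : (s e₁).1 * r₁ + (s e₁).2 * r₂ = r₁ :=
    congrArg Subtype.val (LinearMap.congr_fun hs e₁)
  rw [hα, hβ] at hsec
  have hone : α * r₁ + β * r₂ = 1 := (isWeaklyRegular_pair_iff.1 h.toIsWeaklyRegular).1
    (by simp only [smul_eq_mul]; linear_combination hsec)
  refine h.top_ne_smul ?_
  rw [smul_eq_mul, Ideal.mul_top, eq_comm, Ideal.eq_top_iff_one, Ideal.ofList_cons,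
    Ideal.ofList_singleton, ← Ideal.span_insert]
  exact Ideal.mem_span_pair.2 ⟨α, β, hone⟩

open CategoryTheory

theorem projectiveDimension_eq_two {M : Type u} [AddCommGroup M] [Module R M] (f : R →ₗ[R] M)
    (hf : Function.Surjective f) (hker : LinearMap.ker f = Ideal.span {r₁, r₂})
    (h : IsRegular R [r₁, r₂]) : projectiveDimension (ModuleCat.of R M) = 2 := by
  have hR : Projective (ModuleCat.of R R) := (IsProjective.iff_projective R).1 inferInstance
  have hR2 : Projective (ModuleCat.of R (R × R)) :=
    (IsProjective.iff_projective (R × R)).1 inferInstance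
  have hM := LinearMap.shortExact_shortComplexKer hf
  have hspan := LinearMap.shortExact_shortComplexKer (spanPairMap_surjective (r₁ := r₁) (r₂ := r₂))
  apply le_antisymm
  · refine (projectiveDimension_le_iff _ 2).2 ((hM.hasProjectiveDimensionLT_X₃_iff 1 hR).2 ?_)
    change HasProjectiveDimensionLT (ModuleCat.of R (LinearMap.ker f)) 2
    rw [hker]
    refine (hspan.hasProjectiveDimensionLT_X₃_iff 0 hR2).2 ?_
    rw [← projective_iff_hasProjectiveDimensionLT_one]
    have := projective_ker_spanPairMap h.toIsWeaklyRegular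
    exact (IsProjective.iff_projective (LinearMap.ker (spanPairMap r₁ r₂))).1 this
  · refine (projectiveDimension_ge_iff _ 2).2 fun hlt => not_projective_span_pair h ?_
    have hlt' := (hM.hasProjectiveDimensionLT_X₃_iff 0 hR).1 hlt
    change HasProjectiveDimensionLT (ModuleCat.of R (LinearMap.ker f)) 1 at hlt'
    rw [hker, ← projective_iff_hasProjectiveDimensionLT_one] at hlt'
    exact (IsProjective.iff_projective _).2 hlt'

theorem homologicalDimension_eq_two {A : Type u} [CommRing A] (φ : R →+* A)
    (hφ : Function.Surjective φ) (h : IsRegular R [r₁, r₂])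
    (hker : RingHom.ker φ = Ideal.span {r₁, r₂}) : homologicalDimension φ = 2 := by
  let := Module.compHom A φ
  let f : R →ₗ[R] A := { toFun := φ, map_add' := map_add φ, map_smul' := map_mul φ }
  exact projectiveDimension_eq_two f hφ hker h

end Koszul

section Resolution

variable {R : Type*} [CommRing R] {r₁ r₂ : R}

theorem exact_mulVecLin_koszul (h : IsWeaklyRegular R [r₁, r₂]) :
    Function.Exact (Matrix.mulVecLin !![-r₂; r₁]) (Matrix.mulVecLin !![r₁, r₂]) := by
  intro v
  simp only [Matrix.mulVecLin_apply, Set.mem_range]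
  constructor
  · intro hv
    obtain ⟨z, h0, h1⟩ := exists_of_mul_add_mul_eq_zero h (x := v 0) (y := v 1)
      (by simpa [Matrix.mulVec, dotProduct] using congrFun hv 0)
    refine ⟨![z], ?_⟩
    ext i
    fin_cases i <;> simp [h0, h1, mul_comm z]
  · rintro ⟨y, rfl⟩
    ext i
    fin_cases i
    simp [Matrix.mulVec, dotProduct]
    ring

theorem injective_mulVecLin_koszul (h : IsSMulRegular R r₁) :
    Function.Injective (Matrix.mulVecLin !![-r₂; r₁]) := by
  intro u v huv
  ext i
  fin_cases i
  exact h (by simpa [Matrix.mulVec, dotProduct] using congrFun huv 1)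

theorem exists_mulVecLin_eq_iff_mem_span_pair (v : Fin 1 → R) :
    (∃ u, Matrix.mulVecLin !![r₁, r₂] u = v) ↔ v 0 ∈ Ideal.span {r₁, r₂} := by
  rw [Ideal.mem_span_pair]
  constructor
  · rintro ⟨u, rfl⟩
    exact ⟨u 0, u 1, by simp [Matrix.mulVec, dotProduct, mul_comm]⟩
  · rintro ⟨a, b, hab⟩
    refine ⟨![a, b], ?_⟩
    ext i
    fin_cases i
    simpa [Matrix.mulVec, dotProduct, mul_comm] using hab

variable {K A : Type*} [Field K] [CommRing A] [Algebra K A] {𝒜 : ℕ → Submodule K A} {m : ℕ}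
  {w : Fin m → ℕ}

theorem mulVec_mem_twistedDegree {b c : List ℕ}
    {M : Matrix (Fin b.length) (Fin c.length) (MvPolynomial (Fin m) K)}
    (hM : ∀ i j, ∃ d, (M i j).IsWeightedHomogeneous w d ∧ b.get i + d = c.get j) {e : ℕ}
    {v : Fin c.length → MvPolynomial (Fin m) K} (hv : v ∈ twistedDegree w c e) :
    M.mulVec v ∈ twistedDegree w b e := by
  classical
  intro i μ hμ
  rw [Matrix.mulVec, dotProduct, coeff_sum] at hμ
  obtain ⟨j, -, hj⟩ := Finset.exists_ne_zero_of_sum_ne_zero hμ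
  rw [coeff_mul] at hj
  obtain ⟨x, hsum, hne⟩ := Finset.exists_ne_zero_of_sum_ne_zero hj
  obtain ⟨d, hMd, hd⟩ := hM i j
  have hν : Finsupp.weight w x.1 = d := hMd (left_ne_zero_of_mul hne)
  have hξ : Finsupp.weight w x.2 + c.get j = e := hv j x.2 (right_ne_zero_of_mul hne)
  rw [← Finset.HasAntidiagonal.mem_antidiagonal.1 hsum, map_add, hν]
  omega

theorem constantCoeff_mulVec_eq_zero {ι κ : Type*} [Fintype κ]
    {M : Matrix ι κ (MvPolynomial (Fin m) K)}
    (hM : ∀ i j, constantCoeff (M i j) = 0) (v : κ → MvPolynomial (Fin m) K) (i : ι) :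
    constantCoeff (M.mulVec v i) = 0 := by
  simp [Matrix.mulVec, dotProduct, hM]

theorem constantCoeff_eq_zero_of_isWeightedHomogeneous {p : MvPolynomial (Fin m) K} {d : ℕ}
    (hp : p.IsWeightedHomogeneous w d) (hd : d ≠ 0) : constantCoeff p = 0 :=
  hp.coeff_eq_zero 0 (by simpa using hd.symm)

section TwistedDegree

variable {r₁ r₂ : MvPolynomial (Fin m) K} {d₁ d₂ e : ℕ}

theorem mulVec_row_mem_twistedDegree (hr₁ : r₁.IsWeightedHomogeneous w d₁)
    (hr₂ : r₂.IsWeightedHomogeneous w d₂) {v : Fin 2 → MvPolynomial (Fin m) K}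
    (hv : v ∈ twistedDegree w [d₁, d₂] e) :
    Matrix.mulVec !![r₁, r₂] v ∈ twistedDegree w [0] e := by
  refine mulVec_mem_twistedDegree (fun i j => ?_) hv
  fin_cases i
  fin_cases j
  exacts [⟨d₁, hr₁, zero_add _⟩, ⟨d₂, hr₂, zero_add _⟩]

theorem mulVec_column_mem_twistedDegree (hr₁ : r₁.IsWeightedHomogeneous w d₁)
    (hr₂ : r₂.IsWeightedHomogeneous w d₂) {v : Fin 1 → MvPolynomial (Fin m) K}
    (hv : v ∈ twistedDegree w [d₁ + d₂] e) :
    Matrix.mulVec !![-r₂; r₁] v ∈ twistedDegree w [d₁, d₂] e := by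
  refine mulVec_mem_twistedDegree (fun i j => ?_) hv
  fin_cases j
  fin_cases i
  exacts [⟨d₂, (weightedHomogeneousSubmodule K w d₂).neg_mem hr₂, rfl⟩,
    ⟨d₁, hr₁, add_comm d₂ d₁⟩]

end TwistedDegree

theorem hasMinimalFreeResolution_of_isWeaklyRegular {φ : MvPolynomial (Fin m) K →ₐ[K] A}
    (hφ : Function.Surjective φ) (hdeg : ∀ e p, p.IsWeightedHomogeneous w e → φ p ∈ 𝒜 e)
    {r₁ r₂ : MvPolynomial (Fin m) K} {d₁ d₂ : ℕ} (hr₁ : r₁.IsWeightedHomogeneous w d₁)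
    (hr₂ : r₂.IsWeightedHomogeneous w d₂) (hd₁ : d₁ ≠ 0) (hd₂ : d₂ ≠ 0)
    (h : IsWeaklyRegular (MvPolynomial (Fin m) K) [r₁, r₂])
    (hker : RingHom.ker φ = Ideal.span {r₁, r₂}) :
    HasMinimalFreeResolution 𝒜 w φ [[0], [d₁, d₂], [d₁ + d₂]] := by
  let R := MvPolynomial (Fin m) K
  let ε : (Fin 1 → R) →ₛₗ[(φ : R →+* A)] A :=
    { toFun := fun v => φ (v 0)
      map_add' := fun u v => map_add φ _ _
      map_smul' := fun c v => map_mul φ _ _ }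
  have hc₁ := constantCoeff_eq_zero_of_isWeightedHomogeneous hr₁ hd₁
  have hc₂ := constantCoeff_eq_zero_of_isWeightedHomogeneous hr₂ hd₂
  refine ⟨ε, fun i => match i with
    | 0 => Matrix.mulVecLin !![r₁, r₂]
    | 1 => Matrix.mulVecLin !![-r₂; r₁]
    | _ + 2 => 0, fun a => ?_, fun v => ?_, fun i => ?_, fun e v hv => ?_, fun i e v hv => ?_,
    fun i v => ?_⟩
  · obtain ⟨p, rfl⟩ := hφ a
    exact ⟨fun _ => p, rfl⟩
  · refine Iff.trans ?_ (exists_mulVecLin_eq_iff_mem_span_pair v).symm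
    rw [← hker]
    rfl
  · match i with
    | 0 => exact exact_mulVecLin_koszul h
    | 1 =>
      exact (LinearMap.exact_zero_iff_injective _ _).2
        (injective_mulVecLin_koszul (isWeaklyRegular_pair_iff.1 h).1)
    | _ + 2 =>
      intro v
      exact ⟨fun _ => ⟨0, Subsingleton.elim (α := Fin 0 → R) _ _⟩, fun _ => rfl⟩
  · exact hdeg e (v (0 : Fin 1)) fun μ hμ => hv (0 : Fin 1) μ hμ
  · match i with
    | 0 => exact mulVec_row_mem_twistedDegree hr₁ hr₂ hv
    | 1 => exact mulVec_column_mem_twistedDegree hr₁ hr₂ hv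
    | _ + 2 => exact Submodule.zero_mem _
  · match i with
    | 0 =>
      exact constantCoeff_mulVec_eq_zero (M := !![r₁, r₂])
        (by simp [Fin.forall_fin_two, hc₁, hc₂]) v
    | 1 =>
      exact constantCoeff_mulVec_eq_zero (M := !![-r₂; r₁])
        (by simp [Fin.forall_fin_two, hc₁, hc₂]) v
    | _ + 2 => exact fun _ => map_zero _

end Resolution

/-! ### Minimal systems of generators -/

section Generators

theorem injective_of_surjective_ringEndomorphism {R : Type*} [CommRing R] [IsNoetherianRing R]
    (θ : R →+* R) (hθ : Function.Surjective θ) : Function.Injective θ := by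
  let kerPow : ℕ →o Ideal R :=
    ⟨fun n => RingHom.ker (θ ^ n), monotone_nat_of_le_succ fun n x hx => by
      rw [RingHom.mem_ker] at hx ⊢
      rw [pow_succ', RingHom.mul_def, RingHom.comp_apply, hx, map_zero]⟩
  obtain ⟨n, hn⟩ := monotone_stabilizes_iff_noetherian.2 ‹IsNoetherianRing R› kerPow
  have hsurj : Function.Surjective (θ ^ n : R →+* R) := by
    rw [RingHom.coe_pow]
    exact hθ.iterate n
  rw [injective_iff_map_eq_zero]
  intro x hx
  obtain ⟨y, rfl⟩ := hsurj x
  have hy : y ∈ kerPow (n + 1) := by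
    change (θ ^ (n + 1)) y = 0
    rw [pow_succ', RingHom.mul_def, RingHom.comp_apply, hx]
  rwa [← hn (n + 1) n.le_succ] at hy

section Weight

variable {σ R : Type*} [CommRing R] {w : σ → ℕ}

theorem eq_single_of_weight_le (hw : ∀ i, 0 < w i) {μ : σ →₀ ℕ} {j : σ} (hj : μ j ≠ 0)
    (hle : Finsupp.weight w μ ≤ w j) : μ = Finsupp.single j 1 := by
  classical
  obtain ⟨ν, rfl⟩ : ∃ ν, μ = Finsupp.single j 1 + ν :=
    ⟨μ - Finsupp.single j 1, (add_tsub_cancel_of_le (by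
      rw [Finsupp.single_le_iff]; omega)).symm⟩
  rw [map_add, Finsupp.weight_single, one_smul] at hle
  have hν : ν = 0 := by
    ext i
    by_contra hi
    have h1 := Finsupp.le_weight_of_ne_zero' w hi
    have := hw i
    omega
  rw [hν, add_zero]

theorem mem_supported_of_forall_coeff {p : MvPolynomial σ R} {s : Set σ}
    (h : ∀ μ, coeff μ p ≠ 0 → ∀ j, μ j ≠ 0 → j ∈ s) : p ∈ supported R s := by
  rw [mem_supported]
  intro j hj
  obtain ⟨μ, hμ, hj⟩ := (mem_vars_iff_mem_support j).1 hj
  exact h μ (mem_support_iff.1 hμ) j (Finsupp.mem_support_iff.1 hj)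

theorem coeff_single_eq_zero_of_mem_supported {p : MvPolynomial σ R} {s : Set σ}
    (h : p ∈ supported R s) {i : σ} (hi : i ∉ s) {n : ℕ} (hn : n ≠ 0) :
    coeff (Finsupp.single i n) p = 0 := by
  by_contra hne
  exact hi (mem_supported.1 h ((mem_vars_iff_mem_support i).2
    ⟨_, mem_support_iff.2 hne, by simp [hn]⟩))

theorem mem_idealOfVars_sq_of_isWeightedHomogeneous {p : MvPolynomial σ R} {d : ℕ}
    (hp : p.IsWeightedHomogeneous w d) (hd : d ≠ 0) (hw : ∀ i, w i ≠ d) :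
    p ∈ idealOfVars σ R ^ 2 := by
  rw [mem_pow_idealOfVars_iff']
  intro μ hμ
  by_contra hne
  have hwt : Finsupp.weight w μ = d := hp hne
  obtain h | h : μ.degree = 0 ∨ μ.degree = 1 := by omega
  · rw [Finsupp.degree_eq_zero_iff] at h
    simp [h, hd.symm] at hwt
  · obtain ⟨i, rfl⟩ := (Finsupp.sum_eq_one_iff _).1 h
    exact hw i (by simpa [Finsupp.weight_single] using hwt)

end Weight

variable {K A : Type*} [Field K] [CommRing A] [Algebra K A] {𝒜 : ℕ → Submodule K A}

section Graded

variable {σ : Type*} {f : σ → A} {w : σ → ℕ}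

theorem mem_adjoin_image_iff {s : Set σ} {x : A} :
    x ∈ Algebra.adjoin K (f '' s) ↔ ∃ p ∈ supported K s, aeval f p = x := by
  have hmap : (supported K s).map (aeval f) = Algebra.adjoin K (f '' s) := by
    simp [supported_eq_adjoin_X, AlgHom.map_adjoin, Set.image_image]
  rw [← hmap]
  rfl

theorem aeval_mem_of_isWeightedHomogeneous [SetLike.GradedMonoid 𝒜] (hf : ∀ i, f i ∈ 𝒜 (w i))
    {p : MvPolynomial σ K} {e : ℕ} (hp : p.IsWeightedHomogeneous w e) : aeval f p ∈ 𝒜 e := by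
  rw [aeval_def, eval₂_eq]
  refine Submodule.sum_mem _ fun μ hμ => ?_
  rw [← Algebra.smul_def]
  refine Submodule.smul_mem _ _ ?_
  rw [← hp (mem_support_iff.1 hμ)]
  exact SetLike.prod_pow_mem_graded 𝒜 w f μ fun k _ => hf k

theorem decompose_aeval [GradedAlgebra 𝒜] (hf : ∀ i, f i ∈ 𝒜 (w i)) (p : MvPolynomial σ K)
    (e : ℕ) :
    (DirectSum.decompose 𝒜 (aeval f p) e : A) = aeval f (weightedHomogeneousComponent w e p) := by
  induction p using MvPolynomial.induction_on' with
  | monomial μ c =>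
    have hμ := isWeightedHomogeneous_monomial w μ c rfl
    have hmem := aeval_mem_of_isWeightedHomogeneous hf hμ
    rw [weightedHomogeneousComponent_of_mem hμ]
    split_ifs with he
    · rw [he, DirectSum.decompose_of_mem_same 𝒜 hmem]
    · rw [DirectSum.decompose_of_mem_ne 𝒜 hmem (Ne.symm he), map_zero]
  | add p q hp hq =>
    rw [map_add, DirectSum.decompose_add, DirectSum.add_apply, Submodule.coe_add, hp, hq, map_add,
      map_add]

theorem aeval_weightedHomogeneousComponent_of_mem [GradedAlgebra 𝒜] (hf : ∀ i, f i ∈ 𝒜 (w i))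
    {p : MvPolynomial σ K} {e : ℕ} (hp : aeval f p ∈ 𝒜 e) :
    aeval f (weightedHomogeneousComponent w e p) = aeval f p := by
  rw [← decompose_aeval hf, DirectSum.decompose_of_mem_same 𝒜 hp]

end Graded

namespace IsMinimalGenerators

variable {m n : ℕ} {f : Fin m → A} {w : Fin m → ℕ} {g : Fin n → A} {v : Fin n → ℕ}

theorem of_ker_le_idealOfVars_sq (hf : ∀ i, f i ∈ 𝒜 (w i))
    (hsurj : Function.Surjective (aeval (R := K) f))
    (hker : RingHom.ker (aeval (R := K) f) ≤ idealOfVars (Fin m) K ^ 2) :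
    IsMinimalGenerators 𝒜 f w where
  homogeneous := hf
  generates := by rwa [Algebra.adjoin_range_eq_range_aeval, AlgHom.range_eq_top]
  irredundant i hi := by
    obtain ⟨p, hp, hpi⟩ := mem_adjoin_image_iff.1 hi
    have hmem : X i - p ∈ RingHom.ker (aeval (R := K) f) := by
      rw [RingHom.mem_ker, map_sub, aeval_X, hpi, sub_self]
    have hcoeff := (mem_pow_idealOfVars_iff' _ _).1 (hker hmem) (Finsupp.single i 1) (by simp)
    rw [coeff_sub, coeff_single_eq_zero_of_mem_supported hp (by simp) one_ne_zero] at hcoeff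
    simp at hcoeff

theorem surjective_aeval (h : IsMinimalGenerators 𝒜 f w) :
    Function.Surjective (aeval (R := K) f) := by
  rw [← AlgHom.range_eq_top, ← Algebra.adjoin_range_eq_range_aeval, h.generates]

theorem weight_pos (h : IsMinimalGenerators 𝒜 f w) (h₀ : 𝒜 0 ≤ 1) (i : Fin m) : 0 < w i := by
  by_contra hi
  have hfi := h.homogeneous i
  rw [Nat.eq_zero_of_not_pos hi] at hfi
  obtain ⟨c, hc⟩ := Submodule.mem_one.1 (h₀ hfi)
  exact h.irredundant i (hc ▸ Subalgebra.algebraMap_mem _ c)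

theorem coeff_single_eq_zero_of_isWeightedHomogeneous (h : IsMinimalGenerators 𝒜 f w)
    (h₀ : 𝒜 0 ≤ 1) {p : MvPolynomial (Fin m) K} {i : Fin m}
    (hp : p.IsWeightedHomogeneous w (w i)) (hker : aeval f p = 0) :
    coeff (Finsupp.single i 1) p = 0 := by
  classical
  by_contra hc
  set c := coeff (Finsupp.single i 1) p with hcdef
  have hsupp : X i - C c⁻¹ * p ∈ supported K {j | j ≠ i} := by
    refine mem_supported_of_forall_coeff fun μ hμ j hj => ?_
    rintro rfl
    obtain rfl : μ = Finsupp.single j 1 := by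
      refine eq_single_of_weight_le (h.weight_pos h₀) hj ?_
      have hq := (isWeightedHomogeneous_X K w j).sub
        ((weightedHomogeneousSubmodule K w (w j)).smul_mem c⁻¹ hp)
      rw [smul_eq_C_mul] at hq
      exact (hq hμ).le
    rw [coeff_sub, coeff_C_mul, coeff_X, if_pos rfl, ← hcdef, inv_mul_cancel₀ hc,
      sub_self] at hμ
    exact hμ rfl
  refine h.irredundant i (mem_adjoin_image_iff.2 ⟨_, hsupp, ?_⟩)
  rw [map_sub, map_mul, hker, mul_zero, sub_zero, aeval_X]

variable [GradedAlgebra 𝒜]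

theorem coeff_single_eq_zero (h : IsMinimalGenerators 𝒜 f w) (h₀ : 𝒜 0 ≤ 1)
    {p : MvPolynomial (Fin m) K} (hp : aeval f p = 0) (i : Fin m) :
    coeff (Finsupp.single i 1) p = 0 := by
  classical
  have hcomp := h.coeff_single_eq_zero_of_isWeightedHomogeneous h₀ (i := i)
    (weightedHomogeneousComponent_isWeightedHomogeneous (w i) p) (by
      rw [aeval_weightedHomogeneousComponent_of_mem h.homogeneous (hp ▸ Submodule.zero_mem _), hp])
  rwa [coeff_weightedHomogeneousComponent, if_pos (by simp [Finsupp.weight_single])] at hcomp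

theorem surjective_endomorphism (h : IsMinimalGenerators 𝒜 f w) (h₀ : 𝒜 0 ≤ 1)
    (θ : MvPolynomial (Fin m) K →ₐ[K] MvPolynomial (Fin m) K)
    (hθ : ∀ i, (θ (X i)).IsWeightedHomogeneous w (w i)) (hθf : ∀ p, aeval f (θ p) = aeval f p) :
    Function.Surjective θ := by
  suffices key : ∀ d i, w i = d → X i ∈ θ.range by
    rw [← AlgHom.range_eq_top, eq_top_iff, ← adjoin_range_X, Algebra.adjoin_le_iff]
    rintro _ ⟨i, rfl⟩
    exact key _ i rfl
  intro d
  induction d using Nat.strong_induction_on with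
  | _ d ih =>
    rintro i rfl
    have hsupp : θ (X i) - X i ∈ supported K {j | w j < w i} := by
      refine mem_supported_of_forall_coeff fun μ hμ j hj => ?_
      by_contra hlt
      have hwt : Finsupp.weight w μ = w i := ((hθ i).sub (isWeightedHomogeneous_X K w i)) hμ
      rw [eq_single_of_weight_le (h.weight_pos h₀) hj (hwt.le.trans (not_lt.1 hlt))] at hμ
      exact hμ (h.coeff_single_eq_zero h₀ (by rw [map_sub, hθf, sub_self]) j)
    have hle : supported K {j | w j < w i} ≤ θ.range := by
      rw [supported_eq_adjoin_X, Algebra.adjoin_le_iff]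
      rintro _ ⟨j, hj, rfl⟩
      exact ih _ hj j rfl
    have hsub := θ.range.sub_mem (θ.mem_range_self (X i)) (hle hsupp)
    rwa [sub_sub_cancel] at hsub

theorem exists_graded_lift (hf : IsMinimalGenerators 𝒜 f w) (hg : ∀ j, g j ∈ 𝒜 (v j)) :
    ∃ β : MvPolynomial (Fin n) K →ₐ[K] MvPolynomial (Fin m) K,
      (∀ e p, p.IsWeightedHomogeneous v e → (β p).IsWeightedHomogeneous w e) ∧
      ∀ p, aeval f (β p) = aeval g p := by
  have hlift : ∀ j, ∃ p : MvPolynomial (Fin m) K, p.IsWeightedHomogeneous w (v j) ∧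
      aeval f p = g j := by
    intro j
    obtain ⟨p, hp⟩ := hf.surjective_aeval (g j)
    refine ⟨_, weightedHomogeneousComponent_isWeightedHomogeneous (v j) p, ?_⟩
    rw [aeval_weightedHomogeneousComponent_of_mem hf.homogeneous (hp ▸ hg j), hp]
  choose b hb hbg using hlift
  refine ⟨aeval b, fun e p hp => ?_, fun p => ?_⟩
  · have := WeightedHomogeneousSubmodule.gradedMonoid (R := K) (w := w)
    exact aeval_mem_of_isWeightedHomogeneous (𝒜 := weightedHomogeneousSubmodule K w) hb hp
  · rw [← AlgHom.comp_apply, comp_aeval]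
    simp only [hbg]

theorem exists_graded_algEquiv (hf : IsMinimalGenerators 𝒜 f w) (hg : IsMinimalGenerators 𝒜 g v)
    (h₀ : 𝒜 0 ≤ 1) :
    ∃ β : MvPolynomial (Fin n) K ≃ₐ[K] MvPolynomial (Fin m) K,
      (∀ e p, p.IsWeightedHomogeneous v e → (β p).IsWeightedHomogeneous w e) ∧
      ∀ p, aeval f (β p) = aeval g p := by
  obtain ⟨β, hβ, hβf⟩ := hf.exists_graded_lift hg.homogeneous
  obtain ⟨α, hα, hαg⟩ := hg.exists_graded_lift hf.homogeneous
  have hβα : Function.Surjective (β.comp α) := hf.surjective_endomorphism h₀ _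
    (fun i => hβ _ _ (hα _ _ (isWeightedHomogeneous_X K w i)))
    (fun p => by rw [AlgHom.comp_apply, hβf, hαg])
  have hαβ : Function.Surjective (α.comp β) := hg.surjective_endomorphism h₀ _
    (fun i => hα _ _ (hβ _ _ (isWeightedHomogeneous_X K v i)))
    (fun p => by rw [AlgHom.comp_apply, hαg, hβf])
  have hinj : Function.Injective (α.comp β) :=
    injective_of_surjective_ringEndomorphism (α.comp β).toRingHom hαβ
  rw [AlgHom.coe_comp] at hβα hinj
  exact ⟨AlgEquiv.ofBijective β ⟨hinj.of_comp, hβα.of_comp⟩, hβ, hβf⟩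

end IsMinimalGenerators

end Generators

/-! ### The grading of the algebra of invariants -/

section GradedInvariants

theorem coeff_aeval_X_pow_mul_C {σ R S : Type*} [CommRing R] [CommRing S] [Algebra R S]
    (w : σ → ℕ) (g : σ → S) (P : MvPolynomial σ R) (e : ℕ) :
    (aeval (fun s => Polynomial.X ^ w s * Polynomial.C (g s)) P).coeff e =
      aeval g (weightedHomogeneousComponent w e P) := by
  induction P using MvPolynomial.induction_on' with
  | monomial μ c =>
    have hprod : (μ.prod fun s k => (Polynomial.X ^ w s * Polynomial.C (g s)) ^ k) =
        Polynomial.C (μ.prod fun s k => g s ^ k) * Polynomial.X ^ Finsupp.weight w μ := by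
      simp only [Finsupp.weight_apply, Finsupp.sum, Finsupp.prod, mul_pow,
        Finset.prod_mul_distrib, ← map_pow, ← map_prod, ← pow_mul, Finset.prod_pow_eq_pow_sum,
        smul_eq_mul, mul_comm]
    rw [aeval_monomial, hprod, IsScalarTower.algebraMap_apply R S, Polynomial.algebraMap_eq,
      ← mul_assoc, ← Polynomial.C_mul, Polynomial.coeff_C_mul_X_pow,
      weightedHomogeneousComponent_of_mem (isWeightedHomogeneous_monomial w μ c rfl)]
    split_ifs
    · rw [aeval_monomial]
    · rw [map_zero]
  | add P Q hP hQ => rw [map_add, Polynomial.coeff_add, hP, hQ, map_add, map_add]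

theorem isWeightedHomogeneous_of_aeval_X_pow_mul_C {σ R : Type*} [CommRing R] {w : σ → ℕ}
    {P : MvPolynomial σ R} {d : ℕ}
    (h : aeval (fun s => Polynomial.X ^ w s * Polynomial.C (X s : MvPolynomial σ R)) P =
      Polynomial.X ^ d * Polynomial.C P) : P.IsWeightedHomogeneous w d := by
  have hd := coeff_aeval_X_pow_mul_C w (X : σ → MvPolynomial σ R) P d
  rw [h, mul_comm, Polynomial.coeff_C_mul_X_pow, if_pos rfl, aeval_X_left_apply] at hd
  rw [hd]
  exact weightedHomogeneousComponent_isWeightedHomogeneous d P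

variable {K : Type*} [Field K] {n d : ℕ}

theorem act_smul (g : SL(2, K)) (t : K) (a : Fin (d + 1) → K) : act g (t • a) = t • act g a := by
  have hform : binaryForm (t • a) = C t * binaryForm a := by
    simp only [binaryForm, Finset.mul_sum, Pi.smul_apply, smul_eq_mul, C_mul, mul_assoc]
  ext i
  rw [act, hform, map_mul, ← algebraMap_eq, AlgHom.commutes, algebraMap_eq, coeff_C_mul]
  rfl

theorem homogeneousComponent_mem_invariants [Infinite K]
    {P : MvPolynomial (Fin n × Fin (d + 1)) K} (hP : P ∈ invariants K n d) (e : ℕ) :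
    homogeneousComponent e P ∈ invariants K n d := by
  intro g a
  have hcoeff (z : Fin n × Fin (d + 1) → K) : eval z (homogeneousComponent e P) =
      (aeval (fun s => Polynomial.X ^ 1 * Polynomial.C (z s)) P).coeff e :=
    (coeff_aeval_X_pow_mul_C 1 z P e).symm
  have heval (z : Fin n × Fin (d + 1) → K) (t : K) :
        (aeval (fun s => Polynomial.X ^ 1 * Polynomial.C (z s)) P).eval t =
      eval (fun s => t * z s) P := by
    rw [← Polynomial.coe_evalRingHom, map_aeval, eval, pow_one]
    congr 2
    · ext; simp
    · ext s; simp [mul_comm (z s)]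
  rw [hcoeff, hcoeff]
  congr 1
  refine Polynomial.funext fun t => ?_
  rw [heval, heval]
  have ht := hP g fun j => t • a j
  simp only [act_smul] at ht
  exact ht

instance : SetLike.GradedMonoid (invariantsOfDegree K n d) where
  one_mem := isHomogeneous_one _ _
  mul_mem _ _ _ _ h₁ h₂ := IsHomogeneous.mul h₁ h₂

theorem homogeneousComponent_coeAddMonoidHom
    (x : DirectSum ℕ fun e => invariantsOfDegree K n d e) (e : ℕ) :
    homogeneousComponent e
      (DirectSum.coeAddMonoidHom (invariantsOfDegree K n d) x : invariants K n d).val =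
      (x e : invariants K n d).val := by
  induction x using DirectSum.induction_on with
  | zero => simp
  | of k P =>
    have hP : (P : invariants K n d).val ∈ homogeneousSubmodule _ K k := P.2
    rw [DirectSum.coeAddMonoidHom_of, homogeneousComponent_of_mem hP]
    split_ifs with h
    · rw [h, DirectSum.of_eq_same]
    · rw [DirectSum.of_eq_of_ne _ _ _ h]
      rfl
  | add x y hx hy => simpa using congrArg₂ (· + ·) hx hy

theorem isInternal_invariantsOfDegree [Infinite K] :
    DirectSum.IsInternal (invariantsOfDegree K n d) := by
  refine ⟨fun x y hxy => ?_, fun P => ?_⟩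
  · ext e : 3
    rw [← homogeneousComponent_coeAddMonoidHom, hxy, homogeneousComponent_coeAddMonoidHom]
  · refine ⟨∑ e ∈ Finset.range (P.val.totalDegree + 1), DirectSum.of _ e
      ⟨⟨_, homogeneousComponent_mem_invariants P.2 e⟩,
        homogeneousComponent_isHomogeneous e P.val⟩, Subtype.ext ?_⟩
    simp [DirectSum.coeAddMonoidHom_of, sum_homogeneousComponent]

noncomputable instance [Infinite K] : GradedAlgebra (invariantsOfDegree K n d) where
  toDecomposition := isInternal_invariantsOfDegree.chooseDecomposition

theorem invariantsOfDegree_zero_le_one : invariantsOfDegree K n d 0 ≤ 1 := by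
  intro P hP
  have hP' : P.val.IsHomogeneous 0 := hP
  refine Submodule.mem_one.2 ⟨coeff 0 P.val, Subtype.ext ?_⟩
  rw [← homogeneousComponent_eq_self hP', homogeneousComponent_zero]
  simp

end GradedInvariants

/-! ### The basic invariants of a pair of cubic forms -/

section Cubics

variable {S T F : Type*} [CommRing S] [CommRing T] [FunLike F S T] [RingHomClass F S T]

/-- The discriminant of the cubic form `a 0 * x ^ 3 + a 1 * x ^ 2 * y + a 2 * x * y ^ 2 +
a 3 * y ^ 3`. -/
def cubicDisc (a : Fin 4 → S) : S :=
  a 1 ^ 2 * a 2 ^ 2 - 4 * a 0 * a 2 ^ 3 - 4 * a 1 ^ 3 * a 3 + 18 * a 0 * a 1 * a 2 * a 3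
    - 27 * a 0 ^ 2 * a 3 ^ 2

/-- The polarization of `cubicDisc` of bidegree `(3, 1)`: the coefficient of `t` in
`cubicDisc (a + t • b)`. -/
def cubicDisc₁ (a b : Fin 4 → S) : S :=
  2 * a 1 * a 2 ^ 2 * b 1 + 2 * a 1 ^ 2 * a 2 * b 2 - 4 * (b 0 * a 2 ^ 3 + 3 * a 0 * a 2 ^ 2 * b 2)
    - 4 * (3 * a 1 ^ 2 * b 1 * a 3 + a 1 ^ 3 * b 3)
    + 18 * (b 0 * a 1 * a 2 * a 3 + a 0 * b 1 * a 2 * a 3 + a 0 * a 1 * b 2 * a 3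
      + a 0 * a 1 * a 2 * b 3)
    - 54 * (a 0 * b 0 * a 3 ^ 2 + a 0 ^ 2 * a 3 * b 3)

/-- The polarization of `cubicDisc` of bidegree `(2, 2)`: the coefficient of `t ^ 2` in
`cubicDisc (a + t • b)`. -/
def cubicDisc₂ (a b : Fin 4 → S) : S :=
  a 1 ^ 2 * b 2 ^ 2 + 4 * a 1 * b 1 * a 2 * b 2 + b 1 ^ 2 * a 2 ^ 2
    - 12 * (a 0 * a 2 * b 2 ^ 2 + b 0 * a 2 ^ 2 * b 2)
    - 12 * (a 1 * b 1 ^ 2 * a 3 + a 1 ^ 2 * b 1 * b 3)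
    + 18 * (b 0 * b 1 * a 2 * a 3 + b 0 * a 1 * b 2 * a 3 + b 0 * a 1 * a 2 * b 3
      + a 0 * b 1 * b 2 * a 3 + a 0 * b 1 * a 2 * b 3 + a 0 * a 1 * b 2 * b 3)
    - 27 * (a 0 ^ 2 * b 3 ^ 2 + 4 * a 0 * b 0 * a 3 * b 3 + b 0 ^ 2 * a 3 ^ 2)

/-- The Hessian of a cubic form as a quadratic form, divided by `-4`. -/
def cubicHessian (a : Fin 4 → S) : Fin 3 → S :=
  ![a 1 ^ 2 - 3 * a 0 * a 2, a 1 * a 2 - 9 * a 0 * a 3, a 2 ^ 2 - 3 * a 1 * a 3]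

/-- The second transvectant of a quadratic form and a cubic form, up to a constant: a linear form,
identified with a vector of the plane by the area form. -/
def contraction (h : Fin 3 → S) (b : Fin 4 → S) : Fin 2 → S :=
  ![3 * h 0 * b 3 - h 1 * b 2 + h 2 * b 1, -(h 0 * b 2 - h 1 * b 1 + 3 * h 2 * b 0)]

/-- The gradient of a quadratic form, as an endomorphism of the plane: linear forms are identified
with vectors by the area form. -/
def quadraticEnd (h : Fin 3 → S) (x : Fin 2 → S) : Fin 2 → S :=
  ![h 1 * x 0 + 2 * h 2 * x 1, -(2 * h 0 * x 0 + h 1 * x 1)]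

/-- The area form of the plane. -/
def area (x y : Fin 2 → S) : S := x 0 * y 1 - x 1 * y 0

/-- The invariant alternating bilinear form on binary cubic forms, up to a constant. -/
def cubicPairing (a b : Fin 4 → S) : S := 3 * a 0 * b 3 - a 1 * b 2 + a 2 * b 1 - 3 * a 3 * b 0

/-- The invariant of bidegree `(3, 3)`: the area of the two linear covariants of bidegrees `(2, 1)`
and `(1, 2)`. -/
def covariantArea (a b : Fin 4 → S) : S :=
  area (contraction (cubicHessian a) b) (contraction (cubicHessian b) a)

/-- The composition of the cubic form `a` with the linear map whose matrix has the columns `x` and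
`y`. -/
def cubicComp (a : Fin 4 → S) (x y : Fin 2 → S) : Fin 4 → S :=
  ![a 0 * x 0 ^ 3 + a 1 * x 0 ^ 2 * x 1 + a 2 * x 0 * x 1 ^ 2 + a 3 * x 1 ^ 3,
    3 * a 0 * x 0 ^ 2 * y 0 + a 1 * (x 0 ^ 2 * y 1 + 2 * x 0 * y 0 * x 1)
      + a 2 * (2 * x 0 * x 1 * y 1 + y 0 * x 1 ^ 2) + 3 * a 3 * x 1 ^ 2 * y 1,
    3 * a 0 * x 0 * y 0 ^ 2 + a 1 * (2 * x 0 * y 0 * y 1 + y 0 ^ 2 * x 1)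
      + a 2 * (x 0 * y 1 ^ 2 + 2 * y 0 * x 1 * y 1) + 3 * a 3 * x 1 * y 1 ^ 2,
    a 0 * y 0 ^ 3 + a 1 * y 0 ^ 2 * y 1 + a 2 * y 0 * y 1 ^ 2 + a 3 * y 1 ^ 3]

/-- The seven basic invariants of a pair `z` of binary cubic forms. -/
def basicInvariant (z : Fin 2 → Fin 4 → S) : Fin 7 → S :=
  ![cubicDisc (z 0), cubicDisc₁ (z 0) (z 1), cubicDisc₂ (z 0) (z 1), cubicDisc₁ (z 1) (z 0),
    cubicDisc (z 1), cubicPairing (z 0) (z 1), covariantArea (z 0) (z 1)]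

/-- The degrees of the basic invariants. -/
def basicDegree : Fin 7 → ℕ := ![4, 4, 4, 4, 4, 2, 6]

theorem map_basicInvariant (φ : F) (z : Fin 2 → Fin 4 → S) :
    φ ∘ basicInvariant z = basicInvariant fun j => φ ∘ z j := by
  ext i
  fin_cases i <;> simp [basicInvariant, cubicDisc, cubicDisc₁, cubicDisc₂, cubicPairing,
    covariantArea, area, contraction, cubicHessian, map_ofNat]

theorem basicInvariant_smul (t : S) (z : Fin 2 → Fin 4 → S) (i : Fin 7) :
    basicInvariant (t • z) i = t ^ basicDegree i * basicInvariant z i := by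
  fin_cases i <;> simp [basicInvariant, cubicDisc, cubicDisc₁, cubicDisc₂, cubicPairing,
    covariantArea, area, contraction, cubicHessian, basicDegree] <;> ring

theorem cubicDisc_cubicComp (a : Fin 4 → S) (x y : Fin 2 → S) :
    cubicDisc (cubicComp a x y) = area x y ^ 6 * cubicDisc a := by
  simp only [cubicDisc, cubicComp, area, Matrix.cons_val]
  ring

theorem cubicPairing_cubicComp (a b : Fin 4 → S) (x y : Fin 2 → S) :
    cubicPairing (cubicComp a x y) (cubicComp b x y) = area x y ^ 3 * cubicPairing a b := by
  simp only [cubicPairing, cubicComp, area, Matrix.cons_val]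
  ring

theorem cubicHessian_cubicComp (a : Fin 4 → S) (x y : Fin 2 → S) :
    cubicHessian (cubicComp a x y) = area x y ^ 2 •
      ![cubicHessian a 0 * x 0 ^ 2 + cubicHessian a 1 * x 0 * x 1 + cubicHessian a 2 * x 1 ^ 2,
        2 * cubicHessian a 0 * x 0 * y 0 + cubicHessian a 1 * (x 0 * y 1 + x 1 * y 0)
          + 2 * cubicHessian a 2 * x 1 * y 1,
        cubicHessian a 0 * y 0 ^ 2 + cubicHessian a 1 * y 0 * y 1
          + cubicHessian a 2 * y 1 ^ 2] := by
  ext i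
  fin_cases i <;> simp [cubicHessian, cubicComp, area] <;> ring

theorem contraction_cubicHessian_cubicComp (a b : Fin 4 → S) (x y : Fin 2 → S) :
    contraction (cubicHessian (cubicComp a x y)) (cubicComp b x y) = area x y ^ 4 •
      ![area (contraction (cubicHessian a) b) y, area x (contraction (cubicHessian a) b)] := by
  rw [cubicHessian_cubicComp]
  generalize cubicHessian a = h
  ext i
  fin_cases i <;> simp [contraction, cubicComp, area] <;> ring

theorem covariantArea_cubicComp (a b : Fin 4 → S) (x y : Fin 2 → S) :
    covariantArea (cubicComp a x y) (cubicComp b x y) = area x y ^ 9 * covariantArea a b := by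
  simp only [covariantArea, contraction_cubicHessian_cubicComp]
  generalize contraction (cubicHessian a) b = u
  generalize contraction (cubicHessian b) a = v
  simp only [area, Matrix.cons_val, Pi.smul_apply, smul_eq_mul]
  ring

theorem cubicDisc_add_X_smul (a b : Fin 4 → S) :
    cubicDisc (Polynomial.C ∘ a + (Polynomial.X : Polynomial S) • (Polynomial.C ∘ b)) =
      Polynomial.C (cubicDisc a) + Polynomial.C (cubicDisc₁ a b) * Polynomial.X
        + Polynomial.C (cubicDisc₂ a b) * Polynomial.X ^ 2
        + Polynomial.C (cubicDisc₁ b a) * Polynomial.X ^ 3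
        + Polynomial.C (cubicDisc b) * Polynomial.X ^ 4 := by
  simp only [cubicDisc, cubicDisc₁, cubicDisc₂, Pi.add_apply, Pi.smul_apply, smul_eq_mul,
    Function.comp_apply, map_add, map_sub, map_mul, map_pow, map_ofNat]
  ring

theorem cubicComp_add_X_smul (a b : Fin 4 → S) (x y : Fin 2 → S) :
    cubicComp (Polynomial.C ∘ a + (Polynomial.X : Polynomial S) • (Polynomial.C ∘ b))
        (Polynomial.C ∘ x) (Polynomial.C ∘ y) =
      Polynomial.C ∘ cubicComp a x y +
        (Polynomial.X : Polynomial S) • (Polynomial.C ∘ cubicComp b x y) := by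
  ext i : 1
  fin_cases i <;> simp [cubicComp, map_ofNat] <;> ring

theorem cubicDisc_polarizations_cubicComp (a b : Fin 4 → S) (x y : Fin 2 → S) :
    cubicDisc₁ (cubicComp a x y) (cubicComp b x y) = area x y ^ 6 * cubicDisc₁ a b ∧
      cubicDisc₂ (cubicComp a x y) (cubicComp b x y) = area x y ^ 6 * cubicDisc₂ a b := by
  have harea : area (Polynomial.C ∘ x) (Polynomial.C ∘ y) = Polynomial.C (area x y) := by
    simp [area]
  have h := cubicDisc_cubicComp (Polynomial.C ∘ a + (Polynomial.X : Polynomial S) •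
    (Polynomial.C ∘ b)) (Polynomial.C ∘ x) (Polynomial.C ∘ y)
  rw [cubicComp_add_X_smul, cubicDisc_add_X_smul, cubicDisc_add_X_smul, harea, ← map_pow] at h
  constructor
  · simpa [-map_pow, Polynomial.coeff_X, Polynomial.coeff_C] using congrArg (Polynomial.coeff · 1) h
  · simpa [-map_pow, Polynomial.coeff_X, Polynomial.coeff_C] using congrArg (Polynomial.coeff · 2) h

theorem basicInvariant_cubicComp (z : Fin 2 → Fin 4 → S) {x y : Fin 2 → S} (h : area x y = 1) :
    (basicInvariant fun j => cubicComp (z j) x y) = basicInvariant z := by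
  simp only [basicInvariant, cubicDisc_cubicComp, cubicDisc_polarizations_cubicComp,
    cubicPairing_cubicComp, covariantArea_cubicComp, h, one_pow, one_mul]

/-- The relation of degree `8` between the basic invariants. -/
def relation₈ (c : Fin 7 → S) : S :=
  c 2 ^ 2 - 3 * c 1 * c 3 + 12 * c 0 * c 4 - 8 * c 5 * c 6 - 9 * c 5 ^ 4

/-- The relation of degree `12` between the basic invariants. -/
def relation₁₂ (c : Fin 7 → S) : S :=
  72 * c 0 * c 2 * c 4 + 9 * c 1 * c 2 * c 3 - 27 * c 0 * c 3 ^ 2 - 27 * c 4 * c 1 ^ 2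
    - 2 * c 2 ^ 3 - 16 * c 6 ^ 2 - 72 * c 5 ^ 3 * c 6 - 54 * c 5 ^ 6

theorem relation₈_basicInvariant (z : Fin 2 → Fin 4 → S) : relation₈ (basicInvariant z) = 0 := by
  simp only [relation₈, basicInvariant, cubicDisc, cubicDisc₁, cubicDisc₂, cubicPairing,
    covariantArea, area, contraction, cubicHessian, Matrix.cons_val]
  ring

theorem relation₁₂_basicInvariant (z : Fin 2 → Fin 4 → S) :
    relation₁₂ (basicInvariant z) = 0 := by
  simp only [relation₁₂, basicInvariant, cubicDisc, cubicDisc₁, cubicDisc₂, cubicPairing,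
    covariantArea, area, contraction, cubicHessian, Matrix.cons_val]
  ring

theorem map_relation₈ (φ : F) (c : Fin 7 → S) : φ (relation₈ c) = relation₈ (φ ∘ c) := by
  simp [relation₈, map_ofNat]

theorem map_relation₁₂ (φ : F) (c : Fin 7 → S) : φ (relation₁₂ c) = relation₁₂ (φ ∘ c) := by
  simp [relation₁₂, map_ofNat]

/-- The exchange of the two cubic forms, on the values of the basic invariants. -/
def basicSwap (c : Fin 7 → S) : Fin 7 → S := ![c 4, c 3, c 2, c 1, c 0, -c 5, -c 6]

theorem map_basicSwap (φ : F) (c : Fin 7 → S) : φ ∘ basicSwap c = basicSwap (φ ∘ c) := by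
  ext i
  fin_cases i <;> simp [basicSwap]

theorem basicInvariant_comp_swap (z : Fin 2 → Fin 4 → S) :
    basicInvariant (z ∘ Equiv.swap 0 1) = basicSwap (basicInvariant z) := by
  ext i
  fin_cases i <;> simp [basicInvariant, basicSwap, cubicDisc₂, cubicPairing, covariantArea,
    area] <;> ring

end Cubics

section Action

variable {K : Type*} [Field K] {n d : ℕ}

theorem coeff_binaryForm (a : Fin (d + 1) → K) (i : Fin (d + 1)) :
    coeff (Finsupp.single 0 (d - (i : ℕ)) + Finsupp.single 1 (i : ℕ)) (binaryForm a) = a i := by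
  classical
  have hmonomial (c : K) (p q : ℕ) : C c * X 0 ^ p * X 1 ^ q =
      monomial (Finsupp.single (0 : Fin 2) p + Finsupp.single 1 q) c := by
    rw [X_pow_eq_monomial, X_pow_eq_monomial, C_mul_monomial, monomial_mul, mul_one, mul_one]
  simp only [binaryForm, hmonomial, coeff_sum, coeff_monomial]
  rw [Finset.sum_eq_single i]
  · rw [if_pos rfl]
  · intro j _ hj
    refine if_neg fun h => hj (Fin.ext ?_)
    simpa using DFunLike.congr_fun h 1
  · exact fun h => absurd (Finset.mem_univ i) h

theorem linSubst_binaryForm_cubic (g : SL(2, K)) (a : Fin 4 → K) :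
    linSubst g (binaryForm (d := 3) a) =
      binaryForm (d := 3) (cubicComp a (fun i => g⁻¹ i 0) fun i => g⁻¹ i 1) := by
  have hcubic (b : Fin 4 → K) : binaryForm (d := 3) b = C (b 0) * X 0 ^ 3
      + C (b 1) * X 0 ^ 2 * X 1 + C (b 2) * X 0 * X 1 ^ 2 + C (b 3) * X 1 ^ 3 := by
    refine (Fin.sum_univ_four _).trans ?_
    simp
  have hX (i : Fin 2) : linSubst g (X i) = C (g⁻¹ i 0) * X 0 + C (g⁻¹ i 1) * X 1 := by
    rw [linSubst, aeval_X, Fin.sum_univ_two]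
  have hC (c : K) : linSubst g (C c) = C c := (linSubst g).commutes c
  simp only [hcubic, map_add, map_mul, map_pow, hX, hC, cubicComp, Matrix.cons_val, map_ofNat]
  ring

theorem act_cubic (g : SL(2, K)) (a : Fin 4 → K) :
    act (d := 3) g a = cubicComp a (fun i => g⁻¹ i 0) fun i => g⁻¹ i 1 := by
  ext i
  rw [act, linSubst_binaryForm_cubic, coeff_binaryForm]

theorem area_columns {S : Type*} [CommRing S] (M : Matrix (Fin 2) (Fin 2) S) :
    area (fun i => M i 0) (fun i => M i 1) = M.det := by
  rw [Matrix.det_fin_two, area]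
  ring

theorem invariants_val_injective : Function.Injective (invariants K n d).val :=
  Subtype.val_injective

/-- The value of an invariant at a tuple of binary forms. -/
noncomputable def evalForms (z : Fin n → Fin (d + 1) → K) : invariants K n d →ₐ[K] K :=
  (aeval fun s => z s.1 s.2).comp (invariants K n d).val

theorem evalForms_injective [Infinite K] {P Q : invariants K n d}
    (h : ∀ z, evalForms z P = evalForms z Q) : P = Q :=
  invariants_val_injective (MvPolynomial.funext fun z => h fun j k => z (j, k))

/-- The permutation of the forms, as an endomorphism of the algebra of invariants. -/
noncomputable def permuteForms (π : Equiv.Perm (Fin n)) : invariants K n d →ₐ[K] invariants K n d :=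
  ((rename (Prod.map π id)).comp (invariants K n d).val).codRestrict _ fun P g a => by
    simp only [AlgHom.comp_apply, Subalgebra.coe_val, eval_rename]
    exact P.2 g (a ∘ π)

theorem permuteForms_swap_permuteForms_swap (i j : Fin n) (P : invariants K n d) :
    permuteForms (Equiv.swap i j) (permuteForms (Equiv.swap i j) P) = P := by
  refine invariants_val_injective ?_
  change rename _ (rename _ P.val) = P.val
  rw [rename_rename, show Prod.map (Equiv.swap i j) id ∘ Prod.map (Equiv.swap i j) id = id by
    ext s <;> simp, rename_id_apply]

end Action

section BasicInvariants

variable {K : Type*} [Field K]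

theorem relation₈_isWeightedHomogeneous :
    (relation₈ (X : Fin 7 → MvPolynomial (Fin 7) K)).IsWeightedHomogeneous basicDegree 8 := by
  refine isWeightedHomogeneous_of_aeval_X_pow_mul_C ?_
  simp [relation₈, basicDegree, map_ofNat]
  ring

theorem relation₁₂_isWeightedHomogeneous :
    (relation₁₂ (X : Fin 7 → MvPolynomial (Fin 7) K)).IsWeightedHomogeneous basicDegree 12 := by
  refine isWeightedHomogeneous_of_aeval_X_pow_mul_C ?_
  simp [relation₁₂, basicDegree, map_ofNat]
  ring

theorem basicInvariant_X_isHomogeneous (i : Fin 7) :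
    (basicInvariant (fun j k => (X (j, k) : MvPolynomial (Fin 2 × Fin 4) K)) i).IsHomogeneous
      (basicDegree i) := by
  refine isWeightedHomogeneous_of_aeval_X_pow_mul_C ?_
  rw [← Function.comp_apply (f := aeval _), map_basicInvariant,
    ← Function.comp_apply (f := Polynomial.C), map_basicInvariant, ← basicInvariant_smul]
  congr 1
  ext j k : 2
  simp

theorem basicInvariant_X_mem_invariants (i : Fin 7) :
    basicInvariant (fun j k => (X (j, k) : MvPolynomial (Fin 2 × Fin 4) K)) i ∈
      invariants K 2 3 := by
  intro g a
  have heval (z : Fin 2 × Fin 4 → K) :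
      eval z (basicInvariant (fun j k => (X (j, k) : MvPolynomial (Fin 2 × Fin 4) K)) i) =
        basicInvariant (fun j k => z (j, k)) i := by
    rw [← Function.comp_apply (f := eval z), map_basicInvariant]
    simp [Function.comp_def]
  rw [heval, heval]
  simp only [act_cubic]
  rw [basicInvariant_cubicComp _ (by rw [area_columns, Matrix.SpecialLinearGroup.det_coe])]

variable (K) in
/-- The basic invariants as elements of the algebra of invariants. -/
noncomputable def basic (i : Fin 7) : invariants K 2 3 :=
  ⟨basicInvariant (fun j k => X (j, k)) i, basicInvariant_X_mem_invariants i⟩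

theorem basic_mem_invariantsOfDegree (i : Fin 7) :
    basic K i ∈ invariantsOfDegree K 2 3 (basicDegree i) :=
  basicInvariant_X_isHomogeneous i

theorem val_comp_basic :
    (invariants K 2 3).val ∘ basic K = basicInvariant fun j k => X (j, k) :=
  _root_.funext fun _ => rfl

theorem evalForms_comp_basic (z : Fin 2 → Fin 4 → K) :
    evalForms (d := 3) z ∘ basic K = basicInvariant z := by
  rw [evalForms, AlgHom.coe_comp, Function.comp_assoc, val_comp_basic, map_basicInvariant]
  simp only [Function.comp_def, aeval_X]

theorem permuteForms_comp_basic :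
    permuteForms (Equiv.swap 0 1) ∘ basic K = basicSwap (basic K) := by
  have hval : (invariants K 2 3).val ∘ permuteForms (Equiv.swap 0 1) =
      rename (Prod.map (Equiv.swap 0 1) id) ∘ (invariants K 2 3).val := rfl
  refine invariants_val_injective.comp_left ?_
  change (invariants K 2 3).val ∘ _ = (invariants K 2 3).val ∘ _
  rw [← Function.comp_assoc, hval, Function.comp_assoc, map_basicSwap, val_comp_basic,
    ← basicInvariant_comp_swap, map_basicInvariant]
  simp only [Function.comp_def, rename_X, Prod.map_apply, id]

theorem relation₈_basic : relation₈ (basic K) = 0 := by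
  refine invariants_val_injective ?_
  rw [map_relation₈, val_comp_basic, relation₈_basicInvariant, map_zero]

theorem relation₁₂_basic : relation₁₂ (basic K) = 0 := by
  refine invariants_val_injective ?_
  rw [map_relation₁₂, val_comp_basic, relation₁₂_basicInvariant, map_zero]

end BasicInvariants

/-! ### The frame of linear covariants -/

section Frame

variable {S T F : Type*} [CommRing S] [CommRing T] [FunLike F S T] [RingHomClass F S T]

/-- The linear covariant of bidegree `(2, 1)` of a pair of cubic forms, scaled by `4` so that
`frameCoeff` has integer coefficients. -/
def frameFst (z : Fin 2 → Fin 4 → S) : Fin 2 → S :=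
  (4 : S) • contraction (cubicHessian (z 0)) (z 1)

/-- The linear covariant of bidegree `(4, 1)`: the image of `frameFst z` under the endomorphism
given by the Hessian of the first form. -/
def frameSnd (z : Fin 2 → Fin 4 → S) : Fin 2 → S :=
  quadraticEnd (cubicHessian (z 0)) (frameFst z)

/-- A sixth of the area of the frame of linear covariants, in terms of the basic invariants. -/
def frameArea (c : Fin 7 → S) : S := -3 * c 1 ^ 2 - 12 * c 0 * c 5 ^ 2 + 8 * c 0 * c 2

/-- The coefficients of the two cubic forms in the frame of linear covariants, in terms of the
basic invariants. -/
def frameCoeff (c : Fin 7 → S) : Fin 2 → Fin 4 → S :=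
  let a₀ := 36 * c 1 ^ 2 * c 5 + 64 * c 0 * c 6 - 96 * c 0 * c 2 * c 5 + 144 * c 0 * c 5 ^ 3
  let a₁ := 54 * c 1 ^ 3 - 216 * c 0 * c 1 * c 2 + 432 * c 0 ^ 2 * c 3
  let b₀ := 16 * c 1 * c 6 + 12 * c 1 * c 2 * c 5 + 36 * c 1 * c 5 ^ 3 - 72 * c 0 * c 3 * c 5
  let b₁ := 54 * c 1 ^ 2 * c 5 ^ 2 + 18 * c 1 ^ 2 * c 2 + 288 * c 0 * c 5 * c 6
    + 432 * c 0 * c 5 ^ 4 - 144 * c 0 * c 2 * c 5 ^ 2 - 96 * c 0 * c 2 ^ 2 + 108 * c 0 * c 1 * c 3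
  ![![a₀, a₁, -9 * c 0 * a₀, -c 0 * a₁],
    ![b₀, b₁, -9 * c 0 * b₀, -c 0 * b₁ - 6 * frameArea c ^ 2]]

theorem map_frameArea (φ : F) (c : Fin 7 → S) : φ (frameArea c) = frameArea (φ ∘ c) := by
  simp [frameArea, map_ofNat]

theorem map_frameCoeff (φ : F) (c : Fin 7 → S) (j : Fin 2) (k : Fin 4) :
    φ (frameCoeff c j k) = frameCoeff (φ ∘ c) j k := by
  fin_cases j <;> fin_cases k <;> simp [frameCoeff, map_frameArea, map_ofNat]

theorem contraction_cubicHessian_self (a : Fin 4 → S) : contraction (cubicHessian a) a = 0 := by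
  ext i
  fin_cases i <;> simp [contraction, cubicHessian] <;> ring

theorem disc_cubicHessian (a : Fin 4 → S) :
    cubicHessian a 1 ^ 2 - 4 * cubicHessian a 0 * cubicHessian a 2 = -3 * cubicDisc a := by
  simp only [cubicHessian, cubicDisc, Matrix.cons_val]
  ring

theorem cubicComp_quadraticEnd_two (h : Fin 3 → S) (b : Fin 4 → S) (x : Fin 2 → S) :
    cubicComp b x (quadraticEnd h x) 2 =
      3 * (h 1 ^ 2 - 4 * h 0 * h 2) * cubicComp b x (quadraticEnd h x) 0
        - 2 * area x (quadraticEnd h x) * area (contraction h b) x := by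
  simp only [cubicComp, quadraticEnd, area, contraction, Matrix.cons_val]
  ring

theorem three_mul_cubicComp_quadraticEnd_three (h : Fin 3 → S) (b : Fin 4 → S) (x : Fin 2 → S) :
    3 * cubicComp b x (quadraticEnd h x) 3 =
      (h 1 ^ 2 - 4 * h 0 * h 2) * cubicComp b x (quadraticEnd h x) 1
        - 2 * area x (quadraticEnd h x) * area (contraction h b) (quadraticEnd h x) := by
  simp only [cubicComp, quadraticEnd, area, contraction, Matrix.cons_val]
  ring

theorem area_frame (z : Fin 2 → Fin 4 → S) :
    area (frameFst z) (frameSnd z) = 6 * frameArea (basicInvariant z) := by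
  simp only [frameArea, basicInvariant, cubicDisc, cubicDisc₁, cubicDisc₂, cubicPairing, frameFst,
    frameSnd, area, contraction, cubicHessian, quadraticEnd, Matrix.cons_val, Pi.smul_apply,
    smul_eq_mul]
  ring

theorem cubicComp_frame_zero (z : Fin 2 → Fin 4 → S) (j : Fin 2) :
    cubicComp (z j) (frameFst z) (frameSnd z) 0 = frameCoeff (basicInvariant z) j 0 := by
  fin_cases j <;>
  · simp only [Fin.zero_eta, Fin.mk_one, frameCoeff, basicInvariant, cubicDisc, cubicDisc₁,
      cubicDisc₂, cubicPairing, covariantArea, cubicComp, frameFst, frameSnd, area, contraction,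
      cubicHessian, Matrix.cons_val, Pi.smul_apply, smul_eq_mul]
    ring

theorem cubicComp_frame_one (z : Fin 2 → Fin 4 → S) (j : Fin 2) :
    cubicComp (z j) (frameFst z) (frameSnd z) 1 = frameCoeff (basicInvariant z) j 1 := by
  fin_cases j <;>
  · simp only [Fin.zero_eta, Fin.mk_one, frameCoeff, basicInvariant, cubicDisc, cubicDisc₁,
      cubicDisc₂, cubicPairing, covariantArea, cubicComp, frameFst, frameSnd, area, contraction,
      quadraticEnd, cubicHessian, Matrix.cons_val, Pi.smul_apply, smul_eq_mul]
    ring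

theorem cubicComp_frame_two (z : Fin 2 → Fin 4 → S) (j : Fin 2) :
    cubicComp (z j) (frameFst z) (frameSnd z) 2 = frameCoeff (basicInvariant z) j 2 := by
  have hcoeff : frameCoeff (basicInvariant z) j 2 =
      -9 * cubicDisc (z 0) * frameCoeff (basicInvariant z) j 0 := by
    fin_cases j <;> rfl
  have harea : area (contraction (cubicHessian (z 0)) (z j)) (frameFst z) = 0 := by
    fin_cases j
    · simp [contraction_cubicHessian_self, area]
    · simp only [Fin.mk_one, area, frameFst, Pi.smul_apply, smul_eq_mul]
      ring
  rw [hcoeff, ← cubicComp_frame_zero, frameSnd, cubicComp_quadraticEnd_two, disc_cubicHessian,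
    harea]
  ring

theorem cubicComp_frame_three {K : Type*} [Field K] [CharZero K] (z : Fin 2 → Fin 4 → K)
    (j : Fin 2) :
    cubicComp (z j) (frameFst z) (frameSnd z) 3 = frameCoeff (basicInvariant z) j 3 := by
  have h := three_mul_cubicComp_quadraticEnd_three (cubicHessian (z 0)) (z j) (frameFst z)
  rw [← frameSnd, area_frame, disc_cubicHessian, cubicComp_frame_one] at h
  refine mul_left_cancel₀ (three_ne_zero (α := K)) (h.trans ?_)
  fin_cases j
  · simp [contraction_cubicHessian_self, area, frameCoeff, basicInvariant]
    ring
  · have harea : 4 * area (contraction (cubicHessian (z 0)) (z 1)) (frameSnd z) =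
        6 * frameArea (basicInvariant z) := by
      rw [← area_frame]
      simp only [area, frameFst, Pi.smul_apply, smul_eq_mul]
      ring
    have hcoeff : frameCoeff (basicInvariant z) 1 3 =
        -cubicDisc (z 0) * frameCoeff (basicInvariant z) 1 1
          - 6 * frameArea (basicInvariant z) ^ 2 := rfl
    rw [Fin.mk_one, hcoeff]
    linear_combination (-3 * frameArea (basicInvariant z)) * harea

theorem cubicComp_frame {K : Type*} [Field K] [CharZero K] (z : Fin 2 → Fin 4 → K) (j : Fin 2) :
    cubicComp (z j) (frameFst z) (frameSnd z) = frameCoeff (basicInvariant z) j := by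
  ext k
  fin_cases k
  exacts [cubicComp_frame_zero z j, cubicComp_frame_one z j, cubicComp_frame_two z j,
    cubicComp_frame_three z j]

theorem cubicComp_smul_right (a : Fin 4 → S) (x y : Fin 2 → S) (t : S) (k : Fin 4) :
    cubicComp a x (t • y) k = t ^ (k : ℕ) * cubicComp a x y k := by
  fin_cases k <;> simp [cubicComp] <;> ring

end Frame

theorem exists_pow_mul_mem_of_mem_adjoin {K A : Type*} [CommSemiring K] [CommSemiring A]
    [Algebra K A] {B : Subalgebra K A} {u : A} (hu : u ∈ B) {s : Set A}
    (hs : ∀ x ∈ s, ∃ N : ℕ, u ^ N * x ∈ B) {x : A} (hx : x ∈ Algebra.adjoin K s) :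
    ∃ N : ℕ, u ^ N * x ∈ B := by
  induction hx using Algebra.adjoin_induction with
  | mem x hx => exact hs x hx
  | algebraMap r => exact ⟨0, by rw [pow_zero, one_mul]; exact B.algebraMap_mem r⟩
  | add x y _ _ hx hy =>
    obtain ⟨N, hN⟩ := hx
    obtain ⟨M, hM⟩ := hy
    refine ⟨N + M, ?_⟩
    have hadd : u ^ (N + M) * (x + y) = u ^ M * (u ^ N * x) + u ^ N * (u ^ M * y) := by ring
    rw [hadd]
    exact B.add_mem (B.mul_mem (B.pow_mem hu M) hN) (B.mul_mem (B.pow_mem hu N) hM)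
  | mul x y _ _ hx hy =>
    obtain ⟨N, hN⟩ := hx
    obtain ⟨M, hM⟩ := hy
    refine ⟨N + M, ?_⟩
    rw [pow_add, mul_mul_mul_comm]
    exact B.mul_mem hN hM

section Frame

variable {K : Type*} [Field K]

theorem evalForms_cubicComp {n : ℕ} (z : Fin n → Fin 4 → K) {x y : Fin 2 → K}
    (h : area x y = 1) (P : invariants K n 3) :
    evalForms (d := 3) (fun j => cubicComp (z j) x y) P = evalForms (d := 3) z P := by
  let g : SL(2, K) := ⟨!![x 0, y 0; x 1, y 1], by
    rw [← area_columns, ← h]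
    rfl⟩
  have hact (j : Fin n) : cubicComp (z j) x y = act (d := 3) g⁻¹ (z j) := by
    rw [act_cubic, inv_inv]
    congr 1 <;> ext i <;> fin_cases i <;> rfl
  simp only [hact]
  exact P.2 g⁻¹ z

theorem evalForms_aeval_basic (z : Fin 2 → Fin 4 → K) (p : MvPolynomial (Fin 7) K) :
    evalForms (d := 3) z (aeval (basic K) p) = aeval (basicInvariant z) p := by
  rw [comp_aeval_apply, ← evalForms_comp_basic]
  rfl

theorem aeval_comp_X {σ R A : Type*} [CommSemiring R] [CommSemiring A] [Algebra R A] (c : σ → A) :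
    aeval (R := R) c ∘ X = c :=
  _root_.funext (aeval_X c)

theorem aeval_frameArea {A : Type*} [CommRing A] [Algebra K A] (c : Fin 7 → A) :
    aeval (R := K) c (frameArea X) = frameArea c := by
  rw [map_frameArea, aeval_comp_X]

theorem aeval_frameCoeff {A : Type*} [CommRing A] [Algebra K A] (c : Fin 7 → A) (j : Fin 2)
    (k : Fin 4) : aeval (R := K) c (frameCoeff X j k) = frameCoeff c j k := by
  rw [map_frameCoeff, aeval_comp_X]

/-- The coefficients of the two cubic forms in a frame of area one: the first linear covariant
and a multiple of the second. -/
def unitFrameCoeff (z : Fin 2 → Fin 4 → K) (s : Fin 2 × Fin 4) : K :=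
  (6 * frameArea (basicInvariant z))⁻¹ ^ (s.2 : ℕ) * frameCoeff (basicInvariant z) s.1 s.2

theorem frameArea_pow_mul_unitFrameCoeff {z : Fin 2 → Fin 4 → K}
    (hz : frameArea (basicInvariant z) ≠ 0) (s : Fin 2 × Fin 4) :
    frameArea (basicInvariant z) ^ (s.2 : ℕ) * unitFrameCoeff z s =
      6⁻¹ ^ (s.2 : ℕ) * frameCoeff (basicInvariant z) s.1 s.2 := by
  rw [unitFrameCoeff, ← mul_assoc, ← mul_pow, mul_inv, mul_left_comm, mul_inv_cancel₀ hz, mul_one]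

theorem evalForms_eq_aeval_unitFrameCoeff [CharZero K] {z : Fin 2 → Fin 4 → K}
    (hz : frameArea (basicInvariant z) ≠ 0) (P : invariants K 2 3) :
    evalForms (d := 3) z P = aeval (unitFrameCoeff z) P.val := by
  set r := 6 * frameArea (basicInvariant z) with hr
  have hr₀ : r ≠ 0 := mul_ne_zero (by norm_num) hz
  have harea : area (frameFst z) (r⁻¹ • frameSnd z) = 1 := by
    rw [← inv_mul_cancel₀ hr₀, hr, ← area_frame]
    simp only [area, Pi.smul_apply, smul_eq_mul]
    ring
  rw [← evalForms_cubicComp z harea P]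
  refine congrArg (fun v => aeval v P.val) (_root_.funext fun s => ?_)
  exact (cubicComp_smul_right _ _ _ _ _).trans (by rw [cubicComp_frame, unitFrameCoeff])

theorem exists_frameArea_pow_mul_mem_range [CharZero K] (P : invariants K 2 3) :
    ∃ N : ℕ, frameArea (basic K) ^ N * P ∈ (aeval (R := K) (basic K)).range := by
  let U := {z : Fin 2 → Fin 4 → K // frameArea (basicInvariant z) ≠ 0}
  let ev : invariants K 2 3 →ₐ[K] (U → K) := AlgHom.pi fun z => evalForms (d := 3) z.1
  let coeffs (s : Fin 2 × Fin 4) (z : U) : K := unitFrameCoeff z.1 s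
  have hev (p : MvPolynomial (Fin 7) K) (z : U) :
      ev (aeval (basic K) p) z = aeval (basicInvariant z.1) p := evalForms_aeval_basic z.1 p
  have harea : ev (frameArea (basic K)) ∈ (ev.comp (aeval (basic K))).range :=
    ⟨frameArea X, congrArg ev (aeval_frameArea _)⟩
  have hcoeffs (s : Fin 2 × Fin 4) :
      ev (frameArea (basic K)) ^ (s.2 : ℕ) * coeffs s ∈ (ev.comp (aeval (basic K))).range := by
    refine ⟨C (6⁻¹ ^ (s.2 : ℕ)) * frameCoeff X s.1 s.2, _root_.funext fun z => ?_⟩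
    refine (hev _ z).trans ?_
    rw [← aeval_frameArea (K := K), Pi.mul_apply, Pi.pow_apply, hev, aeval_frameArea, map_mul,
      aeval_frameCoeff, aeval_C]
    exact (frameArea_pow_mul_unitFrameCoeff z.2 s).symm
  have hP : ev P ∈ Algebra.adjoin K (Set.range coeffs) := by
    rw [Algebra.adjoin_range_eq_range_aeval]
    refine ⟨P.val, _root_.funext fun z => ?_⟩
    refine Eq.trans ?_ (evalForms_eq_aeval_unitFrameCoeff z.2 P).symm
    exact comp_aeval_apply (φ := Pi.evalAlgHom K (fun _ : U => K) z) coeffs P.val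
  obtain ⟨N, p, hp⟩ := exists_pow_mul_mem_of_mem_adjoin harea
    (Set.forall_mem_range.2 fun s => ⟨s.2, hcoeffs s⟩) hP
  refine ⟨N + 1, frameArea X * p, evalForms_injective fun z => ?_⟩
  have hz : evalForms (d := 3) z (frameArea (basic K)) = frameArea (basicInvariant z) := by
    rw [map_frameArea, evalForms_comp_basic]
  change evalForms (d := 3) z (aeval (basic K) (frameArea X * p)) = _
  rw [pow_succ', mul_assoc, map_mul, aeval_frameArea, map_mul, map_mul]
  refine (mul_eq_mul_left_iff.2 (or_iff_not_imp_right.2 fun h => ?_))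
  exact (congrFun hp ⟨z, hz ▸ h⟩).trans (by rw [map_mul, map_pow]; rfl)

theorem exists_frameArea_basicSwap_pow_mul_mem_range [CharZero K] (P : invariants K 2 3) :
    ∃ N : ℕ, frameArea (basicSwap (basic K)) ^ N * P ∈ (aeval (R := K) (basic K)).range := by
  obtain ⟨N, p, hp⟩ := exists_frameArea_pow_mul_mem_range (permuteForms (Equiv.swap 0 1) P)
  refine ⟨N, aeval (basicSwap X) p, ?_⟩
  calc aeval (basic K) (aeval (basicSwap X) p)
      = aeval (basicSwap (basic K)) p := by
        rw [comp_aeval_apply, ← aeval_comp_X (R := K) (basic K), ← map_basicSwap, aeval_comp_X]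
        rfl
    _ = permuteForms (Equiv.swap 0 1) (aeval (basic K) p) := by
        rw [comp_aeval_apply, ← permuteForms_comp_basic]
        rfl
    _ = frameArea (basicSwap (basic K)) ^ N * P := by
        refine (congrArg (permuteForms (Equiv.swap 0 1)) hp).trans ?_
        rw [map_mul, map_pow, map_frameArea, permuteForms_comp_basic,
          permuteForms_swap_permuteForms_swap]

end Frame

/-! ### Regularity of the relations -/

section RelationsRegular

variable {K : Type*} [Field K]

theorem frameArea_isWeightedHomogeneous :
    (frameArea (X : Fin 7 → MvPolynomial (Fin 7) K)).IsWeightedHomogeneous basicDegree 8 := by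
  refine isWeightedHomogeneous_of_aeval_X_pow_mul_C ?_
  simp [frameArea, basicDegree, map_ofNat]
  ring

theorem frameArea_basicSwap_isWeightedHomogeneous :
    (frameArea (basicSwap X : Fin 7 → MvPolynomial (Fin 7) K)).IsWeightedHomogeneous
      basicDegree 8 := by
  refine isWeightedHomogeneous_of_aeval_X_pow_mul_C ?_
  simp [frameArea, basicSwap, basicDegree, map_ofNat]
  ring

theorem isUnit_neg_ofNat {σ : Type*} [CharZero K] (n : ℕ) [n.AtLeastTwo] :
    IsUnit (-OfNat.ofNat n : MvPolynomial σ K) := by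
  simpa [map_ofNat] using (IsUnit.mk0 (-OfNat.ofNat n : K) (by simp)).map C

/-- Modulo the preceding elements, the last three are nonzero multiples of the squares of
`X 2`, `X 6` and `X 3`. -/
theorem isWeaklyRegular_X_relations [CharZero K] :
    IsWeaklyRegular (R := MvPolynomial (Fin 7) K) (MvPolynomial (Fin 7) K)
      [X 0, X 1, X 5, X 4, relation₈ X, relation₁₂ X, frameArea (basicSwap X)] := by
  have hmonomials : IsWeaklyRegular (R := MvPolynomial (Fin 7) K) (MvPolynomial (Fin 7) K)
      [X 0, X 1, X 5, X 4, X 2 ^ 2, X 6 ^ 2, X 3 ^ 2] := by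
    simpa using isWeaklyRegular_X_pow (R := K) ![1, 1, 2, 2, 1, 1, 2]
      (l := [0, 1, 5, 4, 2, 6, 3]) (by decide)
  refine isWeaklyRegular_congr (rs := [X 0, X 1, X 5, X 4]) (u := 1) (a := X 2 ^ 2)
    isUnit_one ?_ ?_
  · have h : relation₈ X - 1 * X 2 ^ 2 = (-3 * X 3) * X 1 + (12 * X 0) * X 4
        + (-8 * X 6 - 9 * X 5 ^ 3) * (X 5 : MvPolynomial (Fin 7) K) := by
      rw [relation₈]
      ring
    rw [h]
    refine Ideal.add_mem _ (Ideal.add_mem _ ?_ ?_) ?_ <;>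
      exact Ideal.mul_mem_left _ _ (Ideal.subset_span (by simp))
  refine isWeaklyRegular_congr (rs := [X 0, X 1, X 5, X 4, X 2 ^ 2]) (u := -16) (a := X 6 ^ 2)
    (isUnit_neg_ofNat 16) ?_ ?_
  · have h : relation₁₂ X - -16 * X 6 ^ 2 = (72 * X 2 * X 4 - 27 * X 3 ^ 2) * X 0
        + (9 * X 2 * X 3 - 27 * X 4 * X 1) * X 1 + (-72 * X 5 ^ 2 * X 6 - 54 * X 5 ^ 5) * X 5
        + (-2 * X 2) * (X 2 ^ 2 : MvPolynomial (Fin 7) K) := by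
      rw [relation₁₂]
      ring
    rw [h]
    refine Ideal.add_mem _ (Ideal.add_mem _ (Ideal.add_mem _ ?_ ?_) ?_) ?_ <;>
      exact Ideal.mul_mem_left _ _ (Ideal.subset_span (by simp))
  refine isWeaklyRegular_congr (rs := [X 0, X 1, X 5, X 4, X 2 ^ 2, X 6 ^ 2]) (u := -3)
    (a := X 3 ^ 2) (isUnit_neg_ofNat 3) ?_ hmonomials
  have h : frameArea (basicSwap X) - -3 * X 3 ^ 2 =
      (-12 * X 5 ^ 2 + 8 * X 2) * (X 4 : MvPolynomial (Fin 7) K) := by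
    simp only [frameArea, basicSwap, Matrix.cons_val]
    ring
  rw [h]
  exact Ideal.mul_mem_left _ _ (Ideal.subset_span (by simp))

theorem exists_pos_mem_weightedHomogeneousSubmodule :
    ∀ r ∈ ([X 0, X 1, X 5, X 4, relation₈ X, relation₁₂ X, frameArea (basicSwap X),
      frameArea X] : List (MvPolynomial (Fin 7) K)),
      ∃ k, 0 < k ∧ r ∈ weightedHomogeneousSubmodule K basicDegree k := by
  have hX (i : Fin 7) :
      ∃ k, 0 < k ∧ (X i : MvPolynomial (Fin 7) K) ∈ weightedHomogeneousSubmodule K basicDegree k :=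
    ⟨basicDegree i, by fin_cases i <;> decide, isWeightedHomogeneous_X K basicDegree i⟩
  simp only [List.forall_mem_cons]
  exact ⟨hX 0, hX 1, hX 5, hX 4, ⟨8, by norm_num, relation₈_isWeightedHomogeneous⟩,
    ⟨12, by norm_num, relation₁₂_isWeightedHomogeneous⟩,
    ⟨8, by norm_num, frameArea_basicSwap_isWeightedHomogeneous⟩,
    ⟨8, by norm_num, frameArea_isWeightedHomogeneous⟩, by simp⟩

theorem isWeaklyRegular_X_relations_frameArea_X [CharZero K] :
    IsWeaklyRegular (R := MvPolynomial (Fin 7) K) (MvPolynomial (Fin 7) K)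
      [X 0, relation₈ X, relation₁₂ X, frameArea (basicSwap X), X 1] := by
  let := weightedGradedAlgebra K basicDegree
  have hperm := isWeaklyRegular_of_perm (weightedHomogeneousSubmodule K basicDegree)
    (isWeaklyRegular_X_relations (K := K))
    ((List.perm_append_comm (l₁ := [X 1, X 5, X 4])).cons (X 0))
    fun r hr =>
      exists_pos_mem_weightedHomogeneousSubmodule r (List.mem_append_left [frameArea X] hr)
  exact ((isWeaklyRegular_append_iff _ [X 0, relation₈ X, relation₁₂ X, _, X 1] [X 5, X 4]).1
    hperm).1

theorem isSMulRegular_X_one [CharZero K] :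
    IsSMulRegular (MvPolynomial (Fin 7) K ⧸
      Ideal.ofList ([X 0, relation₈ X, relation₁₂ X] : List (MvPolynomial (Fin 7) K)))
      (X 1 : MvPolynomial (Fin 7) K) := by
  let := weightedGradedAlgebra K basicDegree
  have hswap := isWeaklyRegular_of_perm (weightedHomogeneousSubmodule K basicDegree)
    (isWeaklyRegular_X_relations_frameArea_X (K := K))
    ((((List.Perm.swap (X 1) (frameArea (basicSwap X)) []).cons (relation₁₂ X)).cons
      (relation₈ X)).cons (X 0))
    fun r hr => exists_pos_mem_weightedHomogeneousSubmodule r (by grind)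
  exact (isWeaklyRegular_concat_iff (rs := [X 0, relation₈ X, relation₁₂ X]).1
    ((isWeaklyRegular_append_iff _ [X 0, relation₈ X, relation₁₂ X, X 1] [_]).1 hswap).1).2

theorem isWeaklyRegular_relations_frameArea [CharZero K] :
    IsWeaklyRegular (R := MvPolynomial (Fin 7) K) (MvPolynomial (Fin 7) K)
      [relation₈ X, relation₁₂ X, frameArea X, frameArea (basicSwap X)] := by
  let := weightedGradedAlgebra K basicDegree
  have hsq : IsWeaklyRegular (R := MvPolynomial (Fin 7) K) (MvPolynomial (Fin 7) K)
      [X 0, relation₈ X, relation₁₂ X, frameArea (basicSwap X), X 1 ^ 2] :=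
    isWeaklyRegular_concat_pow (rs := [_, _, _, _]) isWeaklyRegular_X_relations_frameArea_X 2
  have harea : frameArea X - -3 * X 1 ^ 2 =
      (-12 * X 5 ^ 2 + 8 * X 2) * (X 0 : MvPolynomial (Fin 7) K) := by
    rw [frameArea]
    ring
  have hframe := isWeaklyRegular_congr (rs := [_, _, _, _]) (rs' := []) (isUnit_neg_ofNat 3)
    (harea ▸ Ideal.mul_mem_left _ _ (Ideal.subset_span (by simp))) hsq
  have hperm := isWeaklyRegular_of_perm (weightedHomogeneousSubmodule K basicDegree) hframe
    (((((List.Perm.swap (frameArea X) (frameArea (basicSwap X)) []).cons (relation₁₂ X)).cons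
      (relation₈ X)).cons (X 0)).trans (List.perm_append_comm (l₁ := [X 0])))
    fun r hr => exists_pos_mem_weightedHomogeneousSubmodule r (by grind)
  exact ((isWeaklyRegular_append_iff _ [relation₈ X, relation₁₂ X, frameArea X, _] [X 0]).1
    hperm).1

end RelationsRegular

/-! ### Cubic forms with a double root -/

section Slice

variable {K : Type*} [Field K]

theorem aeval_relation₈ {A : Type*} [CommRing A] [Algebra K A] (c : Fin 7 → A) :
    aeval (R := K) c (relation₈ X) = relation₈ c := by
  rw [map_relation₈, aeval_comp_X]

theorem aeval_relation₁₂ {A : Type*} [CommRing A] [Algebra K A] (c : Fin 7 → A) :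
    aeval (R := K) c (relation₁₂ X) = relation₁₂ c := by
  rw [map_relation₁₂, aeval_comp_X]

theorem mem_of_ofNat_mul_mem [CharZero K] {A : Type*} [Ring A] [Algebra K A]
    {B : Subalgebra K A} (n : ℕ) [n.AtLeastTwo] {x : A} (h : OfNat.ofNat n * x ∈ B) : x ∈ B := by
  have hsmul : (OfNat.ofNat n : K)⁻¹ • (OfNat.ofNat n * x) = x := by
    rw [← map_ofNat (algebraMap K A), ← Algebra.smul_def, inv_smul_smul₀ (by simp)]
  exact hsmul ▸ B.smul_mem h _

/-- Where `c 0` vanishes, the relations express `c 1 * c 3` and `c 1 ^ 2 * c 4` through the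
remaining elements. -/
theorem exists_pow_mul_mem_range_of_relations [CharZero K] {A : Type*} [CommRing A] [Algebra K A]
    {c : Fin 7 → A} (h₀ : c 0 = 0) (h₈ : relation₈ c = 0) (h₁₂ : relation₁₂ c = 0) (i : Fin 7) :
    ∃ N : ℕ, c 1 ^ N * c i ∈ (aeval (R := K) (c ∘ ![1, 2, 5, 6])).range := by
  have hc (j : Fin 4) : c (![1, 2, 5, 6] j) ∈ (aeval (R := K) (c ∘ ![1, 2, 5, 6])).range :=
    ⟨X j, aeval_X _ j⟩
  rw [relation₈, h₀] at h₈
  rw [relation₁₂, h₀] at h₁₂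
  fin_cases i
  · exact ⟨0, by simp [h₀]⟩
  · exact ⟨0, by simpa using hc 0⟩
  · exact ⟨0, by simpa using hc 1⟩
  · refine ⟨1, mem_of_ofNat_mul_mem 3 ⟨X 1 ^ 2 - 8 * X 2 * X 3 - 9 * X 2 ^ 4, ?_⟩⟩
    simp [map_ofNat]
    linear_combination h₈
  · refine ⟨2, mem_of_ofNat_mul_mem 27 ⟨X 1 ^ 3 - 24 * X 1 * X 2 * X 3 - 27 * X 1 * X 2 ^ 4
      - 16 * X 3 ^ 2 - 72 * X 2 ^ 3 * X 3 - 54 * X 2 ^ 6, ?_⟩⟩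
    simp [map_ofNat]
    linear_combination 3 * c 2 * h₈ + h₁₂
  · exact ⟨0, by simpa using hc 2⟩
  · exact ⟨0, by simpa using hc 3⟩

theorem basicInvariant_slice_zero {S : Type*} [CommRing S] (b : Fin 4 → S) :
    basicInvariant ![![0, 1, 0, 0], b] 0 = 0 := by
  simp [basicInvariant, cubicDisc]

theorem basicInvariant_slice {S : Type*} [CommRing S] (b : Fin 4 → S) :
    basicInvariant ![![0, 1, 0, 0], b] ∘ ![1, 2, 5, 6] =
      ![-4 * b 3, b 2 ^ 2 - 12 * b 1 * b 3, -b 2, b 2 ^ 3 - 27 * b 0 * b 3 ^ 2] := by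
  ext i
  fin_cases i <;>
    simp [basicInvariant, cubicDisc₁, cubicDisc₂, cubicPairing, covariantArea, area, contraction,
      cubicHessian] <;> ring

theorem exists_basicInvariant_slice_eq [CharZero K] {y : Fin 4 → K} (hy : y 0 ≠ 0) :
    ∃ b : Fin 4 → K, basicInvariant ![![0, 1, 0, 0], b] ∘ ![1, 2, 5, 6] = y := by
  refine ⟨![(-y 2 ^ 3 - y 3) / (27 * (y 0 / 4) ^ 2), -(y 2 ^ 2 - y 1) / (3 * y 0), -y 2,
    -y 0 / 4], ?_⟩
  rw [basicInvariant_slice]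
  ext i
  fin_cases i <;> simp <;> field_simp <;> ring

theorem exists_X_one_pow_mul_sub_rename_mem [CharZero K] (p : MvPolynomial (Fin 7) K) :
    ∃ (N : ℕ) (q : MvPolynomial (Fin 4) K), X 1 ^ N * p - rename ![1, 2, 5, 6] q ∈
      Ideal.ofList [X 0, relation₈ X, relation₁₂ X] := by
  set J : Ideal (MvPolynomial (Fin 7) K) := Ideal.ofList [X 0, relation₈ X, relation₁₂ X]
  let π : MvPolynomial (Fin 7) K →ₐ[K] MvPolynomial (Fin 7) K ⧸ J := Ideal.Quotient.mkₐ K J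
  have hπ {r : MvPolynomial (Fin 7) K} (hr : r ∈ [X 0, relation₈ X, relation₁₂ X]) : π r = 0 :=
    Ideal.Quotient.eq_zero_iff_mem.2 (Ideal.subset_span hr)
  have hX (x : MvPolynomial (Fin 7) K) : π x = aeval (π ∘ X) x := by rw [← aeval_unique]
  have hp : π p ∈ Algebra.adjoin K (Set.range (π ∘ X)) := by
    rw [Algebra.adjoin_range_eq_range_aeval]
    exact ⟨p, (hX p).symm⟩
  obtain ⟨N, q, hq⟩ := exists_pow_mul_mem_of_mem_adjoin
    (B := (aeval (R := K) ((π ∘ X) ∘ ![1, 2, 5, 6])).range) (u := π (X 1)) ⟨X 0, by simp⟩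
    (Set.forall_mem_range.2 (exists_pow_mul_mem_range_of_relations (hπ (by simp))
      (by rw [← map_relation₈, hπ (by simp)]) (by rw [← map_relation₁₂, hπ (by simp)]))) hp
  refine ⟨N, q, Ideal.Quotient.eq.1 ?_⟩
  change π _ = π _
  rw [map_mul, map_pow, hX (rename _ q), aeval_rename]
  exact hq.symm

/-- Pairs whose first form is `x ^ 2 * y` meet the generic orbits in the hypersurface where the
discriminant of the first form vanishes. -/
theorem mem_ofList_of_aeval_slice_eq_zero [CharZero K] {p : MvPolynomial (Fin 7) K}
    (hp : ∀ b : Fin 4 → K, aeval (basicInvariant ![![0, 1, 0, 0], b]) p = 0) :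
    p ∈ Ideal.ofList [X 0, relation₈ X, relation₁₂ X] := by
  obtain ⟨N, q, hq⟩ := exists_X_one_pow_mul_sub_rename_mem p
  have hslice (b : Fin 4 → K) :
      aeval (basicInvariant ![![0, 1, 0, 0], b]) (rename ![1, 2, 5, 6] q) = 0 := by
    have hker : Ideal.ofList [X 0, relation₈ X, relation₁₂ X] ≤
        RingHom.ker (aeval (R := K) (basicInvariant ![![0, 1, 0, 0], b])) := by
      simp [Ideal.ofList_cons, RingHom.mem_ker, aeval_relation₈,
        aeval_relation₁₂, relation₈_basicInvariant, relation₁₂_basicInvariant,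
        basicInvariant_slice_zero]
    have hzero := hker hq
    rw [RingHom.mem_ker, map_sub, map_mul, hp, mul_zero, zero_sub, neg_eq_zero] at hzero
    exact hzero
  have hq₀ : q = 0 := by
    refine (mul_eq_zero.1 (MvPolynomial.funext (p := X 0 * q) (q := 0) fun y => ?_)).resolve_left
      (X_ne_zero 0)
    rw [map_mul, eval_X, map_zero]
    refine mul_eq_zero.2 (or_iff_not_imp_left.2 fun hy => ?_)
    obtain ⟨b, rfl⟩ := exists_basicInvariant_slice_eq hy
    exact (aeval_rename _ _ _).symm.trans (hslice b)
  rw [hq₀, map_zero, sub_zero] at hq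
  exact (isSMulRegular_quotient_iff_mem_of_smul_mem _ _).1 (isSMulRegular_X_one.pow N) p hq

end Slice

/-! ### Generators and relations -/

/-- Geometrically, `φ` induces an isomorphism outside a locus cut out by the regular sequence
`s, t`, so that regular functions extend across it. -/
theorem surjective_of_forall_pow_mul_mem_range {R A : Type*} [CommRing R] [CommRing A]
    (φ : R →+* A) {s t : R} (hs : IsSMulRegular A (φ s))
    (ht : IsSMulRegular (R ⧸ (RingHom.ker φ ⊔ Ideal.span {s})) t)
    (hsx : ∀ x, ∃ N : ℕ, φ s ^ N * x ∈ φ.range) (htx : ∀ x, ∃ N : ℕ, φ t ^ N * x ∈ φ.range) :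
    Function.Surjective φ := by
  have hdiv (y : A) : φ s * y ∈ φ.range → y ∈ φ.range := by
    rintro ⟨p, hp⟩
    obtain ⟨N, q, hq⟩ := htx y
    have hker : t ^ N * p - s * q ∈ RingHom.ker φ := by
      rw [RingHom.mem_ker, map_sub, map_mul, map_mul, map_pow, hp, hq]
      ring
    have hp' : p ∈ RingHom.ker φ ⊔ Ideal.span {s} := by
      refine (isSMulRegular_quotient_iff_mem_of_smul_mem _ _).1 (ht.pow N) p ?_
      rw [smul_eq_mul, ← sub_add_cancel (t ^ N * p) (s * q)]
      exact Submodule.add_mem_sup hker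
        (Ideal.mul_mem_right _ _ (Ideal.mem_span_singleton_self s))
    obtain ⟨k, hk, _, hsr, rfl⟩ := Submodule.mem_sup.1 hp'
    obtain ⟨r, rfl⟩ := Ideal.mem_span_singleton.1 hsr
    rw [map_add, (RingHom.mem_ker).1 hk, zero_add, map_mul] at hp
    exact ⟨r, hs hp⟩
  have hdiv_pow (N : ℕ) (y : A) : φ s ^ N * y ∈ φ.range → y ∈ φ.range := by
    induction N with
    | zero => simp
    | succ N ih => exact fun h => ih (hdiv _ (by rwa [pow_succ', mul_assoc] at h))
  intro x
  obtain ⟨N, hN⟩ := hsx x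
  exact hdiv_pow N x hN

section Generators

variable {K : Type*} [Field K]

theorem span_relations_le_ker :
    Ideal.span {relation₈ X, relation₁₂ X} ≤ RingHom.ker (aeval (R := K) (basic K)) := by
  rw [Ideal.span_le, Set.pair_subset_iff]
  exact ⟨(aeval_relation₈ _).trans relation₈_basic, (aeval_relation₁₂ _).trans relation₁₂_basic⟩

variable [CharZero K]

theorem basic_zero_ne_zero : basic K 0 ≠ 0 := by
  intro h
  have heval := congrFun (evalForms_comp_basic (K := K) ![![0, 1, 1, 0], 0]) 0
  simp [h, basicInvariant, cubicDisc] at heval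

theorem frameArea_basic_ne_zero : frameArea (basic K) ≠ 0 := by
  intro h
  let z : Fin 2 → Fin 4 → K := ![![0, 1, 0, 0], ![0, 0, 0, 1]]
  have heval := map_frameArea (evalForms (d := 3) z) (basic K)
  have hdisc : basicInvariant z 1 = -4 := by simp [z, basicInvariant, cubicDisc₁]
  rw [h, map_zero, evalForms_comp_basic, frameArea, basicInvariant_slice_zero, hdisc] at heval
  norm_num at heval

theorem ker_aeval_basic :
    RingHom.ker (aeval (R := K) (basic K)) = Ideal.span {relation₈ X, relation₁₂ X} := by
  let := weightedGradedAlgebra K basicDegree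
  refine eq_of_le_sup_span_singleton (weightedHomogeneousSubmodule K basicDegree) (k := 4)
    (a := X 0) ?_ (by norm_num) (isWeightedHomogeneous_X K basicDegree 0) ?_ ?_ fun p hp => ?_
  · refine Ideal.homogeneous_span _ _ ?_
    rintro x (rfl | rfl)
    exacts [⟨8, relation₈_isWeightedHomogeneous⟩, ⟨12, relation₁₂_isWeightedHomogeneous⟩]
  · refine (isSMulRegular_quotient_iff_mem_of_smul_mem _ _).2 fun p hp => ?_
    rw [smul_eq_mul, RingHom.mem_ker, map_mul, aeval_X] at hp
    exact (mul_eq_zero.1 hp).resolve_left basic_zero_ne_zero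
  · exact span_relations_le_ker
  · have hslice : p ∈ Ideal.ofList [X 0, relation₈ X, relation₁₂ X] :=
      mem_ofList_of_aeval_slice_eq_zero fun b => by
        rw [← evalForms_aeval_basic, RingHom.mem_ker.1 hp, map_zero]
    rwa [Ideal.ofList_cons, sup_comm, Ideal.ofList_cons, Ideal.ofList_singleton,
      ← Ideal.span_insert] at hslice

theorem aeval_basic_surjective : Function.Surjective (aeval (R := K) (basic K)) := by
  have hs := aeval_frameArea (K := K) (basic K)
  have ht :
      aeval (R := K) (basic K) (frameArea (basicSwap X)) = frameArea (basicSwap (basic K)) := by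
    rw [map_frameArea, map_basicSwap, aeval_comp_X]
  refine surjective_of_forall_pow_mul_mem_range (aeval (R := K) (basic K)).toRingHom
    (s := frameArea X) (t := frameArea (basicSwap X)) ?_ ?_
    (hs ▸ exists_frameArea_pow_mul_mem_range) (ht ▸ exists_frameArea_basicSwap_pow_mul_mem_range)
  · exact hs ▸ IsRegular.isSMulRegular (IsRegular.of_ne_zero frameArea_basic_ne_zero)
  · have hreg := ((isWeaklyRegular_concat_iff (rs := [_, _, _])).1
      (isWeaklyRegular_relations_frameArea (K := K))).2
    have hideal : Ideal.ofList [relation₈ X, relation₁₂ X, frameArea X] =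
        RingHom.ker (aeval (R := K) (basic K)) ⊔ Ideal.span {frameArea X} := by
      rw [ker_aeval_basic, Ideal.ofList_cons, Ideal.ofList_cons, Ideal.ofList_singleton,
        Ideal.span_insert, sup_assoc]
    exact hideal ▸ hreg

theorem basic_isMinimalGenerators :
    IsMinimalGenerators (invariantsOfDegree K 2 3) (basic K) basicDegree := by
  refine .of_ker_le_idealOfVars_sq basic_mem_invariantsOfDegree aeval_basic_surjective ?_
  rw [ker_aeval_basic, Ideal.span_le, Set.pair_subset_iff]
  exact ⟨mem_idealOfVars_sq_of_isWeightedHomogeneous relation₈_isWeightedHomogeneous (by decide)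
      (by decide),
    mem_idealOfVars_sq_of_isWeightedHomogeneous relation₁₂_isWeightedHomogeneous (by decide)
      (by decide)⟩

theorem isRegular_relations :
    IsRegular (MvPolynomial (Fin 7) K)
      [(relation₈ X : MvPolynomial (Fin 7) K), relation₁₂ X] := by
  refine ⟨((isWeaklyRegular_append_iff _ [_, _] _).1 isWeaklyRegular_relations_frameArea).1, ?_⟩
  rw [smul_eq_mul, Ideal.mul_top, Ideal.ofList_cons, Ideal.ofList_singleton, ← Ideal.span_insert,
    ← ker_aeval_basic]
  exact (RingHom.ker_ne_top _).symm

theorem IsMinimalGenerators.exists_isRegular_ker_eq {m : ℕ} {f : Fin m → invariants K 2 3}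
    {w : Fin m → ℕ} (hf : IsMinimalGenerators (invariantsOfDegree K 2 3) f w) :
    ∃ r₁ r₂ : MvPolynomial (Fin m) K,
      r₁.IsWeightedHomogeneous w 8 ∧ r₂.IsWeightedHomogeneous w 12 ∧
      IsRegular (MvPolynomial (Fin m) K) [r₁, r₂] ∧
      RingHom.ker (aeval (R := K) f) = Ideal.span {r₁, r₂} := by
  obtain ⟨β, hβ, hβf⟩ :=
    hf.exists_graded_algEquiv basic_isMinimalGenerators invariantsOfDegree_zero_le_one
  refine ⟨β (relation₈ X), β (relation₁₂ X), hβ _ _ relation₈_isWeightedHomogeneous,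
    hβ _ _ relation₁₂_isWeightedHomogeneous, ?_, ?_⟩
  · refine (AddEquiv.isRegular_congr (e := β.toRingEquiv.toAddEquiv) ?_).1 isRegular_relations
    exact .cons (map_mul β _) (.cons (map_mul β _) .nil)
  · have hcomap : RingHom.ker (aeval (R := K) (basic K)) =
        (RingHom.ker (aeval (R := K) f)).comap β := by
      ext p
      rw [Ideal.mem_comap, RingHom.mem_ker, RingHom.mem_ker, hβf]
    rw [← Ideal.map_comap_of_surjective β β.surjective (RingHom.ker (aeval f)), ← hcomap,
      ker_aeval_basic, Ideal.map_span, Set.image_pair]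

end Generators

end BinaryInvariants

theorem mainTheorem8 (K : Type*) [Field K] [CharZero K] :
    (∃ (m : ℕ) (f : Fin m → BinaryInvariants.invariants K 2 3) (w : Fin m → ℕ),
      BinaryInvariants.IsMinimalGenerators (BinaryInvariants.invariantsOfDegree K 2 3) f w) ∧
    ∀ (m : ℕ) (f : Fin m → BinaryInvariants.invariants K 2 3) (w : Fin m → ℕ),
      BinaryInvariants.IsMinimalGenerators (BinaryInvariants.invariantsOfDegree K 2 3) f w →
      Function.Surjective (MvPolynomial.aeval (R := K) f) ∧
      (∃ r₁ r₂ : MvPolynomial (Fin m) K,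
        r₁.IsWeightedHomogeneous w 8 ∧ r₂.IsWeightedHomogeneous w 12 ∧
        RingTheory.Sequence.IsRegular (MvPolynomial (Fin m) K) [r₁, r₂] ∧
        RingHom.ker (MvPolynomial.aeval (R := K) f) = Ideal.span {r₁, r₂}) ∧
      BinaryInvariants.HasMinimalFreeResolution (BinaryInvariants.invariantsOfDegree K 2 3) w
        (MvPolynomial.aeval f) [[0], [8, 12], [20]] ∧
      BinaryInvariants.homologicalDimension
        (MvPolynomial.aeval (R := K) f : MvPolynomial (Fin m) K →ₐ[K] _).toRingHom = 2 := by
  open BinaryInvariants in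
  refine ⟨⟨7, basic K, basicDegree, basic_isMinimalGenerators⟩, fun m f w hf => ?_⟩
  have hsurj := hf.surjective_aeval
  obtain ⟨r₁, r₂, hr₁, hr₂, hreg, hker⟩ := hf.exists_isRegular_ker_eq
  exact ⟨hsurj, ⟨r₁, r₂, hr₁, hr₂, hreg, hker⟩,
    hasMinimalFreeResolution_of_isWeaklyRegular hsurj
      (fun _ _ hp => aeval_mem_of_isWeightedHomogeneous hf.homogeneous hp) hr₁ hr₂
      (by decide) (by decide) hreg.toIsWeaklyRegular hker,
    homologicalDimension_eq_two _ hsurj hreg hker⟩
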